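/- For a permutation $\sigma\in\mathfrak S_n$, let $M_\sigma$ be its (dense) adjacency matrix: the $n\times n$ $0,1$-matrix whose rows and columns are indexed by $1<\dots<n$ in this order, with a $1$ in position $(x,y)$ if and only if $\sigma(x)<\sigma(y)$. A matrix is \emph{mixed} if at least one of its rows is not constant and at least one of its columns is not constant. A \emph{$k$-almost mixed minor} of a matrix is a pair of partitions of its rows and of its columns into $k$ nonempty intervals $R_1<\dots<R_k$ and $C_1<\dots<C_k$ such that for all $i\ne j$ the submatrix on $R_i\times C_j$ is mixed. Let $\mathcal A_k$ be the class of \emph{$k$-almost mixed free} permutations, i.e. the permutations $\sigma$ such that $M_\sigma$ has no $k$-almost mixed minor. Let $\mathcal S$ be the class of separable permutations, i.e. those obtained from the one-point permutation by direct sums and skew sums (the empty permutation is also counted as separable), and let $\mathcal S^r$ be the class of products (compositions) of $r$ separable permutations of the same size. \textbf{Theorem.} Let $k\ge 1$ and $r\ge 0$ be integers. If $\mathcal A_{k-1}\subseteq\mathcal S^r$, then $\mathcal A_k\subseteq\mathcal S^s$ for \[ s = 3r+12\lceil\log_2 k\rceil+28. \] -/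

import Mathlib

open scoped Pointwise

namespace SepPerm

/-- The direct sum of permutations: `σ` acts on the first `m` positions and values, and `τ` on
the last `n` positions and values. -/
def directSum {m n : ℕ} (σ : Equiv.Perm (Fin m)) (τ : Equiv.Perm (Fin n)) :
    Equiv.Perm (Fin (m + n)) :=
  finSumFinEquiv.symm.trans ((Equiv.sumCongr σ τ).trans finSumFinEquiv)

/-- The skew sum of permutations: the first `m` positions carry the pattern `σ` on the `m`
largest values, and the last `n` positions carry the pattern `τ` on the `n` smallest values. -/
def skewSum {m n : ℕ} (σ : Equiv.Perm (Fin m)) (τ : Equiv.Perm (Fin n)) :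
    Equiv.Perm (Fin (m + n)) :=
  finSumFinEquiv.symm.trans ((Equiv.sumCongr σ τ).trans ((Equiv.sumComm (Fin m) (Fin n)).trans
    (finSumFinEquiv.trans (finCongr (Nat.add_comm n m)))))

/-- Separable permutations: those built from the one-point permutation by direct sums and skew
sums. The empty permutation is counted as separable. -/
inductive Separable : {n : ℕ} → Equiv.Perm (Fin n) → Prop
  | empty : Separable (1 : Equiv.Perm (Fin 0))
  | one : Separable (1 : Equiv.Perm (Fin 1))
  | directSum {m n : ℕ} {σ : Equiv.Perm (Fin m)} {τ : Equiv.Perm (Fin n)} :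
      Separable σ → Separable τ → Separable (SepPerm.directSum σ τ)
  | skewSum {m n : ℕ} {σ : Equiv.Perm (Fin m)} {τ : Equiv.Perm (Fin n)} :
      Separable σ → Separable τ → Separable (SepPerm.skewSum σ τ)

/-- The separable permutations of size `n`. As a set in the group `Equiv.Perm (Fin n)`, its
pointwise power `separablePerms n ^ r` is the set of all products (compositions) of `r` separable
permutations of size `n`. -/
def separablePerms (n : ℕ) : Set (Equiv.Perm (Fin n)) := {σ | Separable σ}

/-- A matrix is horizontal if all its rows are constant. -/
def IsHorizontal {α β γ : Type*} (M : Matrix α β γ) : Prop :=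
  ∀ x y y', M x y = M x y'

/-- A matrix is vertical if all its columns are constant. -/
def IsVertical {α β γ : Type*} (M : Matrix α β γ) : Prop :=
  ∀ x x' y, M x y = M x' y

/-- A matrix is mixed if it is neither horizontal nor vertical. -/
def IsMixed {α β γ : Type*} (M : Matrix α β γ) : Prop :=
  ¬ IsHorizontal M ∧ ¬ IsVertical M

/-- A partition of a linear order into `k` nonempty intervals, enumerated in increasing order. -/
structure IntervalPartition (α : Type*) [LinearOrder α] (k : ℕ) where
  part : Fin k → Set α
  nonempty : ∀ i, (part i).Nonempty
  cover : ∀ x, ∃ i, x ∈ part i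
  ordConnected : ∀ i, (part i).OrdConnected
  lt_of_lt : ∀ i j, i < j → ∀ x ∈ part i, ∀ y ∈ part j, x < y

/-- The cell of a matrix on the rows in `R` and the columns in `C`. -/
def cell {α β γ : Type*} (M : Matrix α β γ) (R : Set α) (C : Set β) : Matrix R C γ :=
  M.submatrix (fun x => x.1) (fun y => y.1)

/-- A `k`-almost mixed minor of `M`: a `k`-division (the rows and the columns are each cut into
`k` intervals) in which every cell off the diagonal is mixed. -/
def HasAlmostMixedMinor {α β γ : Type*} [LinearOrder α] [LinearOrder β]
    (k : ℕ) (M : Matrix α β γ) : Prop :=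
  ∃ (R : IntervalPartition α k) (C : IntervalPartition β k),
    ∀ i j, i ≠ j → IsMixed (cell M (R.part i) (C.part j))

/-- The dense adjacency matrix of a permutation: rows and columns in the natural order, and a `1`
in position `(x, y)` exactly when `σ x < σ y`. -/
def adjMatrix {n : ℕ} (σ : Equiv.Perm (Fin n)) : Matrix (Fin n) (Fin n) ℕ :=
  Matrix.of fun x y => if σ x < σ y then 1 else 0

/-- The `k`-almost mixed free permutations of size `n`. -/
def almostMixedFreePerms (k n : ℕ) : Set (Equiv.Perm (Fin n)) :=
  {σ | ¬ HasAlmostMixedMinor k (adjMatrix σ)}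

end SepPerm

/-! With l = ⌈log₂ k⌉ the proof yields r + 8l + 6 factors, which is within the stated bound. A
permutation is viewed as a passage from the order of positions to the order of values of its points,
and `Chain` counts separable passages. Two facts keep the count low. Passages inside the classes of
an inflation run in parallel with the outer one, so lengths do not add up (`Chain.inflate`). Sorting
stably by 2^l colours costs 2l (`Chain.color_sort`), so two orders that agree within each colour are
4l apart.

Minors arise in two ways. If the parts of a division are all split in value by points lying on one
side of them, those points make up one more part; so points whose gaps are split from one side form
a (k-1)-almost mixed free pattern, at cost r (`chain_of_split`). Blocks, the maximal intervals not
split by outside points, have between any two of them a point beyond the outer split; k blocks whose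
value ranges share a level would thus give a k-minor (`hasMonoMinor_of_common_level`). The ranges
therefore form an interval graph without k-cliques, and k colours make equally coloured ranges
disjoint (`Frame.exists_block_coloring`).

For an interval x of a set G, an order h is built recursively from the blocks of x
(`Frame.exists_isSorting`): r + 4l steps reach h, which sorts all pairs split by G \ x, and 4l more
steps sort each unsplit class. Parallelism keeps both costs constant through the recursion. For x =
G there is a single class, hence r + 8l. The last 6 steps group the points by value relative to the
first and the last point, which then serve as extreme points on the two sides of each group. -/

namespace SepPerm

/-! ### Separable passages between orders on a finite set -/

section Orders

variable {ι κ : Type*}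

/-- Two functions induce the same strict order on `X`. -/
def OrdEq (X : Finset ι) (f g : ι → ℕ) : Prop :=
  ∀ a ∈ X, ∀ b ∈ X, (f a < f b ↔ g a < g b)

/-- The pattern on `X` that leads from the order induced by `f` to the one induced by `g` is
separable. -/
inductive SepOn (f g : ι → ℕ) : Finset ι → Prop
  | small {X : Finset ι} : X.card ≤ 1 → SepOn f g X
  | up {A B X : Finset ι} : SepOn f g A → SepOn f g B → (∀ v, v ∈ X ↔ v ∈ A ∨ v ∈ B) →
      (∀ a ∈ A, ∀ b ∈ B, f a < f b) → (∀ a ∈ A, ∀ b ∈ B, g a < g b) → SepOn f g X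
  | down {A B X : Finset ι} : SepOn f g A → SepOn f g B → (∀ v, v ∈ X ↔ v ∈ A ∨ v ∈ B) →
      (∀ a ∈ A, ∀ b ∈ B, f a < f b) → (∀ a ∈ A, ∀ b ∈ B, g b < g a) → SepOn f g X

/-- The pattern on `X` from the order of `f` to the order of `g` is a product of `r` separable
ones. -/
inductive Chain (X : Finset ι) : ℕ → (ι → ℕ) → (ι → ℕ) → Prop
  | zero {f g : ι → ℕ} : OrdEq X f g → Chain X 0 f g
  | succ {r : ℕ} {f h g : ι → ℕ} : SepOn f h X → Chain X r h g → Chain X (r + 1) f g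

/-- The lexicographic order on `X` given by `c` first and `f` second. -/
def lexOn (X : Finset ι) (c f : ι → ℕ) : ι → ℕ := fun v => c v * (X.sup f + 1) + f v

theorem lexOn_lt_iff {X : Finset ι} {c f : ι → ℕ} {a b : ι} (ha : a ∈ X) (hb : b ∈ X) :
    lexOn X c f a < lexOn X c f b ↔ c a < c b ∨ c a = c b ∧ f a < f b := by
  have h1 : f a < X.sup f + 1 := Nat.lt_succ_of_le (Finset.le_sup ha)
  have h2 : f b < X.sup f + 1 := Nat.lt_succ_of_le (Finset.le_sup hb)
  unfold lexOn
  generalize X.sup f + 1 = N at *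
  rcases lt_trichotomy (c a) (c b) with h | h | h
  · have : (c a + 1) * N ≤ c b * N := Nat.mul_le_mul_right _ h
    simp only [h, true_or, iff_true]
    nlinarith
  · simp [h]
  · have : (c b + 1) * N ≤ c a * N := Nat.mul_le_mul_right _ h
    constructor
    · intro h'; nlinarith
    · intro h'; omega

namespace OrdEq

variable {X : Finset ι} {f g h : ι → ℕ}

theorem refl (X : Finset ι) (f : ι → ℕ) : OrdEq X f f := fun _ _ _ _ => Iff.rfl

theorem symm (H : OrdEq X f g) : OrdEq X g f := fun a ha b hb => (H a ha b hb).symm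

theorem trans (H : OrdEq X f g) (K : OrdEq X g h) : OrdEq X f h :=
  fun a ha b hb => (H a ha b hb).trans (K a ha b hb)

theorem subset {Y : Finset ι} (H : OrdEq X f g) (hY : Y ⊆ X) : OrdEq Y f g :=
  fun a ha b hb => H a (hY ha) b (hY hb)

end OrdEq

namespace SepOn

variable {X : Finset ι} {f g f' g' : ι → ℕ}

theorem congr (H : SepOn f g X) : OrdEq X f f' → OrdEq X g g' → SepOn f' g' X := by
  induction H with
  | small h => exact fun _ _ => .small h
  | @up A B X _ _ hX hf hg ihA ihB =>
    intro h1 h2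
    have hA : A ⊆ X := fun v hv => (hX v).2 (.inl hv)
    have hB : B ⊆ X := fun v hv => (hX v).2 (.inr hv)
    exact .up (ihA (h1.subset hA) (h2.subset hA)) (ihB (h1.subset hB) (h2.subset hB)) hX
      (fun a ha b hb => (h1 a (hA ha) b (hB hb)).1 (hf a ha b hb))
      (fun a ha b hb => (h2 a (hA ha) b (hB hb)).1 (hg a ha b hb))
  | @down A B X _ _ hX hf hg ihA ihB =>
    intro h1 h2
    have hA : A ⊆ X := fun v hv => (hX v).2 (.inl hv)
    have hB : B ⊆ X := fun v hv => (hX v).2 (.inr hv)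
    exact .down (ihA (h1.subset hA) (h2.subset hA)) (ihB (h1.subset hB) (h2.subset hB)) hX
      (fun a ha b hb => (h1 a (hA ha) b (hB hb)).1 (hf a ha b hb))
      (fun a ha b hb => (h2 b (hB hb) a (hA ha)).1 (hg a ha b hb))

theorem symm (H : SepOn f g X) : SepOn g f X := by
  induction H with
  | small h => exact .small h
  | up _ _ hX hf hg ihA ihB => exact .up ihA ihB hX hg hf
  | down _ _ hX hf hg ihA ihB =>
    exact .down ihB ihA (fun v => (hX v).trans Or.comm) (fun a ha b hb => hg b hb a ha)
      (fun a ha b hb => hf b hb a ha)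

theorem injOn (H : SepOn f g X) : ∀ a ∈ X, ∀ b ∈ X, a ≠ b → f a ≠ f b := by
  induction H with
  | small h =>
    intro a ha b hb hab
    exact absurd (Finset.card_le_one.1 h a ha b hb) hab
  | up _ _ hX hf hg ihA ihB =>
    intro a ha b hb hab
    rcases (hX a).1 ha with ha | ha <;> rcases (hX b).1 hb with hb | hb
    · exact ihA a ha b hb hab
    · exact (hf a ha b hb).ne
    · exact (hf b hb a ha).ne'
    · exact ihB a ha b hb hab
  | down _ _ hX hf hg ihA ihB =>
    intro a ha b hb hab
    rcases (hX a).1 ha with ha | ha <;> rcases (hX b).1 hb with hb | hb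
    · exact ihA a ha b hb hab
    · exact (hf a ha b hb).ne
    · exact (hf b hb a ha).ne'
    · exact ihB a ha b hb hab

/-- A pattern is separable if each element is extreme for `g` among the elements that precede it
for `f`. -/
theorem of_extreme [DecidableEq ι] (hinj : ∀ a ∈ X, ∀ b ∈ X, a ≠ b → f a ≠ f b)
    (hext : ∀ m ∈ X, (∀ a ∈ X, f a < f m → g a < g m) ∨ (∀ a ∈ X, f a < f m → g m < g a)) :
    SepOn f g X := by
  revert hinj hext
  -- The `f`-largest point is extreme for `g` in the whole set, so it splits off as a one-point
  -- summand.
  refine Finset.induction_on_max_value (motive := fun X => (∀ a ∈ X, ∀ b ∈ X, a ≠ b → f a ≠ f b) →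
    (∀ m ∈ X, (∀ a ∈ X, f a < f m → g a < g m) ∨ (∀ a ∈ X, f a < f m → g m < g a)) →
    SepOn f g X) f X (fun _ _ => .small (by simp)) ?_
  · intro m s hm hmax ih hinj hext
    have ih' : SepOn f g s := by
      refine ih (fun a ha b hb => hinj a (Finset.mem_insert_of_mem ha) b
        (Finset.mem_insert_of_mem hb)) (fun e he => ?_)
      rcases hext e (Finset.mem_insert_of_mem he) with h | h
      · exact .inl fun a ha => h a (Finset.mem_insert_of_mem ha)
      · exact .inr fun a ha => h a (Finset.mem_insert_of_mem ha)
    have hlt : ∀ a ∈ s, f a < f m := fun a ha =>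
      lt_of_le_of_ne (hmax a ha) (hinj a (Finset.mem_insert_of_mem ha) m
        (Finset.mem_insert_self _ _) (by rintro rfl; exact hm ha))
    have hX : ∀ v, v ∈ insert m s ↔ v ∈ s ∨ v ∈ ({m} : Finset ι) := by
      intro v; rw [Finset.mem_insert, Finset.mem_singleton, or_comm]
    have h1 : SepOn f g {m} := .small (by simp)
    rcases hext m (Finset.mem_insert_self _ _) with h | h
    · refine .up ih' h1 hX ?_ ?_ <;> intro a ha b hb <;> rw [Finset.mem_singleton] at hb <;>
        subst hb
      · exact hlt a ha
      · exact h a (Finset.mem_insert_of_mem ha) (hlt a ha)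
    · refine .down ih' h1 hX ?_ ?_ <;> intro a ha b hb <;> rw [Finset.mem_singleton] at hb <;>
        subst hb
      · exact hlt a ha
      · exact h a (Finset.mem_insert_of_mem ha) (hlt a ha)

theorem refl [DecidableEq ι] (hinj : ∀ a ∈ X, ∀ b ∈ X, a ≠ b → f a ≠ f b) : SepOn f f X :=
  of_extreme hinj fun _ _ => .inl fun _ _ h => h

/-- Separable patterns are closed under inflation. -/
theorem inflate [DecidableEq κ] {β : ι → κ} {F G : κ → ℕ} {E : Finset κ} (hout : SepOn F G E) :
    ∀ X : Finset ι, (∀ v ∈ X, β v ∈ E) → (∀ e ∈ E, SepOn f g (X.filter (β · = e))) →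
    (∀ a ∈ X, ∀ b ∈ X, β a ≠ β b → (f a < f b ↔ F (β a) < F (β b))) →
    (∀ a ∈ X, ∀ b ∈ X, β a ≠ β b → (g a < g b ↔ G (β a) < G (β b))) → SepOn f g X := by
  have key : ∀ {A B E : Finset κ} {X : Finset ι}, (∀ v, v ∈ E ↔ v ∈ A ∨ v ∈ B) →
      (∀ v ∈ X, β v ∈ E) → ∀ v, v ∈ X ↔ v ∈ X.filter (β · ∈ A) ∨ v ∈ X.filter (β · ∈ B) := by
    intro A B E X hE hX v
    simp only [Finset.mem_filter]
    constructor
    · intro hv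
      rcases (hE _).1 (hX v hv) with h | h
      · exact .inl ⟨hv, h⟩
      · exact .inr ⟨hv, h⟩
    · rintro (h | h) <;> exact h.1
  have key2 : ∀ {A E : Finset κ} {X : Finset ι}, (∀ e ∈ A, e ∈ E) →
      (∀ e ∈ E, SepOn f g (X.filter (β · = e))) →
      ∀ e ∈ A, SepOn f g ((X.filter (β · ∈ A)).filter (β · = e)) := by
    intro A E X hA h e he
    have : (X.filter (β · ∈ A)).filter (β · = e) = X.filter (β · = e) := by
      ext v
      simp only [Finset.mem_filter]
      constructor
      · rintro ⟨⟨h1, _⟩, h2⟩; exact ⟨h1, h2⟩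
      · rintro ⟨h1, rfl⟩; exact ⟨⟨h1, he⟩, rfl⟩
    rw [this]; exact h e (hA e he)
  -- Each sum in the decomposition of the outer pattern lifts to a sum of preimages; at a leaf, `X`
  -- lies in one fibre.
  induction hout with
  | @small E h =>
    intro X hX hin _ _
    rcases X.eq_empty_or_nonempty with rfl | ⟨v, hv⟩
    · exact .small (by simp)
    · have : X.filter (β · = β v) = X := by
        refine Finset.filter_true_of_mem fun w hw => ?_
        exact Finset.card_le_one.1 h _ (hX w hw) _ (hX v hv)
      rw [← this]; exact hin _ (hX v hv)
  | @up A B E hSA hSB hE hF hG ihA ihB =>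
    intro X hX hin hf hg
    have hd : ∀ a ∈ A, ∀ b ∈ B, a ≠ b := by
      rintro a ha b hb rfl; exact lt_irrefl _ (hF a ha a hb)
    refine .up (ihA (X.filter (β · ∈ A)) (by simp) (key2 (fun e he => (hE e).2 (.inl he)) hin)
      (fun a ha b hb => hf a (Finset.mem_filter.1 ha).1 b (Finset.mem_filter.1 hb).1)
      (fun a ha b hb => hg a (Finset.mem_filter.1 ha).1 b (Finset.mem_filter.1 hb).1))
      (ihB (X.filter (β · ∈ B)) (by simp) (key2 (fun e he => (hE e).2 (.inr he)) hin)
      (fun a ha b hb => hf a (Finset.mem_filter.1 ha).1 b (Finset.mem_filter.1 hb).1)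
      (fun a ha b hb => hg a (Finset.mem_filter.1 ha).1 b (Finset.mem_filter.1 hb).1))
      (key hE hX) ?_ ?_ <;> intro a ha b hb <;> rw [Finset.mem_filter] at ha hb
    · exact (hf a ha.1 b hb.1 (hd _ ha.2 _ hb.2)).2 (hF _ ha.2 _ hb.2)
    · exact (hg a ha.1 b hb.1 (hd _ ha.2 _ hb.2)).2 (hG _ ha.2 _ hb.2)
  | @down A B E hSA hSB hE hF hG ihA ihB =>
    intro X hX hin hf hg
    have hd : ∀ a ∈ A, ∀ b ∈ B, a ≠ b := by
      rintro a ha b hb rfl; exact lt_irrefl _ (hF a ha a hb)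
    refine .down (ihA (X.filter (β · ∈ A)) (by simp) (key2 (fun e he => (hE e).2 (.inl he)) hin)
      (fun a ha b hb => hf a (Finset.mem_filter.1 ha).1 b (Finset.mem_filter.1 hb).1)
      (fun a ha b hb => hg a (Finset.mem_filter.1 ha).1 b (Finset.mem_filter.1 hb).1))
      (ihB (X.filter (β · ∈ B)) (by simp) (key2 (fun e he => (hE e).2 (.inr he)) hin)
      (fun a ha b hb => hf a (Finset.mem_filter.1 ha).1 b (Finset.mem_filter.1 hb).1)
      (fun a ha b hb => hg a (Finset.mem_filter.1 ha).1 b (Finset.mem_filter.1 hb).1))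
      (key hE hX) ?_ ?_ <;> intro a ha b hb <;> rw [Finset.mem_filter] at ha hb
    · exact (hf a ha.1 b hb.1 (hd _ ha.2 _ hb.2)).2 (hF _ ha.2 _ hb.2)
    · exact (hg b hb.1 a ha.1 (hd _ ha.2 _ hb.2).symm).2 (hG _ ha.2 _ hb.2)

end SepOn

/-! ### Products of separable passages: parallel composition and stable sorting -/

namespace Chain

variable {X : Finset ι} {f g h f' g' : ι → ℕ} {r s : ℕ}

theorem congr (H : Chain X r f g) : ∀ {f'}, OrdEq X f f' → OrdEq X g g' → Chain X r f' g' := by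
  induction H with
  | zero h => exact fun h1 h2 => .zero ((h1.symm.trans h).trans h2)
  | succ h1 _ ih => exact fun h2 h3 => .succ (h1.congr h2 (OrdEq.refl _ _)) (ih (OrdEq.refl _ _) h3)

theorem single (H : SepOn f g X) : Chain X 1 f g := .succ H (.zero (OrdEq.refl _ _))

theorem trans (H : Chain X r f g) (K : Chain X s g h) : Chain X (r + s) f h := by
  induction H with
  | zero h => rw [Nat.zero_add]; exact K.congr h.symm (OrdEq.refl _ _)
  | succ h1 _ ih => rw [Nat.add_right_comm]; exact .succ h1 (ih K)

theorem symm (H : Chain X r f g) : Chain X r g f := by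
  induction H with
  | zero h => exact .zero h.symm
  | succ h1 _ ih => exact ih.trans (single h1.symm)

theorem of_injOn [DecidableEq ι] (hinj : ∀ a ∈ X, ∀ b ∈ X, a ≠ b → f a ≠ f b) (r : ℕ) :
    Chain X r f f := by
  induction r with
  | zero => exact .zero (OrdEq.refl _ _)
  | succ r ih => exact .succ (SepOn.refl hinj) ih

theorem mono [DecidableEq ι] (H : Chain X r f g) (hrs : r ≤ s)
    (hinj : ∀ a ∈ X, ∀ b ∈ X, a ≠ b → g a ≠ g b) : Chain X s f g := by
  obtain ⟨t, rfl⟩ := Nat.exists_eq_add_of_le hrs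
  exact H.trans (of_injOn hinj t)

theorem of_card_le_one (hX : X.card ≤ 1) (r : ℕ) (f g : ι → ℕ) : Chain X r f g := by
  induction r generalizing f with
  | zero =>
    refine .zero fun a ha b hb => ?_
    obtain rfl := Finset.card_le_one.1 hX a ha b hb
    simp
  | succ r ih => exact .succ (.small hX) (ih f)

theorem injOn (H : Chain X r f g) (hinj : ∀ a ∈ X, ∀ b ∈ X, a ≠ b → f a ≠ f b) :
    ∀ a ∈ X, ∀ b ∈ X, a ≠ b → g a ≠ g b := by
  induction H with
  | zero h =>
    intro a ha b hb hab hg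
    rcases lt_or_gt_of_ne (hinj a ha b hb hab) with h' | h'
    · exact ((h a ha b hb).1 h').ne hg
    · exact ((h b hb a ha).1 h').ne' hg
  | succ h1 _ ih => exact ih h1.symm.injOn

/-- Products of `r` separable patterns are closed under inflation. -/
theorem inflate [DecidableEq κ] {β : ι → κ} {F G : κ → ℕ} (hout : Chain (X.image β) r F G)
    (hin : ∀ e ∈ X.image β, Chain (X.filter (β · = e)) r f g)
    (hf : ∀ a ∈ X, ∀ b ∈ X, β a ≠ β b → (f a < f b ↔ F (β a) < F (β b)))
    (hg : ∀ a ∈ X, ∀ b ∈ X, β a ≠ β b → (g a < g b ↔ G (β a) < G (β b))) : Chain X r f g := by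
  have himg : ∀ a ∈ X, β a ∈ X.image β := fun a ha => Finset.mem_image_of_mem _ ha
  have key : ∀ a ∈ X, ∀ b ∈ X, β a = β b → b ∈ X.filter (β · = β a) := fun a ha b hb hab =>
    Finset.mem_filter.2 ⟨hb, hab.symm⟩
  generalize hE : X.image β = E at *
  induction hout generalizing f with
  | @zero F G h =>
    refine .zero fun a ha b hb => ?_
    by_cases hab : β a = β b
    · cases hin _ (himg a ha) with
      | zero h' => exact h' a (key a ha a ha rfl) b (key a ha b hb hab)
    · rw [hf a ha b hb hab, hg a ha b hb hab]; exact h _ (himg a ha) _ (himg b hb)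
  | @succ r F H G h1 h2 ih =>
    have : ∀ e, ∃ h : ι → ℕ, e ∈ E →
        SepOn f h (X.filter (β · = e)) ∧ Chain (X.filter (β · = e)) r h g := by
      intro e
      by_cases he : e ∈ E
      · cases hin e he with
        | @succ _ _ h _ h3 h4 => exact ⟨h, fun _ => ⟨h3, h4⟩⟩
      · exact ⟨f, fun h => absurd h he⟩
    choose η hη using this
    -- The intermediate order follows the outer chain between fibres and the chain of each fibre
    -- inside it, so one step advances all of them.
    set h := lexOn X (fun v => H (β v)) (fun v => η (β v) v) with hh
    have hne : ∀ a ∈ X, ∀ b ∈ X, β a ≠ β b → (h a < h b ↔ H (β a) < H (β b)) := by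
      intro a ha b hb hab
      have := h1.symm.injOn _ (himg a ha) _ (himg b hb) hab
      rw [hh, lexOn_lt_iff ha hb]
      simp [this]
    have heq : ∀ e, OrdEq (X.filter (β · = e)) (η e) h := by
      intro e a ha b hb
      rw [Finset.mem_filter] at ha hb
      rw [hh, lexOn_lt_iff ha.1 hb.1]
      simp [ha.2, hb.2]
    refine .succ (h := h) (h1.inflate X himg (fun e he => ?_) hf hne) (ih hne hg ?_)
    · exact (hη e he).1.congr (OrdEq.refl _ _) (heq e)
    · exact fun e he => (hη e he).2.congr (heq e) (OrdEq.refl _ _)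

/-- A stable sort by one bit may contain 3142, so a single step does not suffice. The first step
brings the zeros to the front in reversed order, and the second one reverses them back. -/
theorem binary_sort [DecidableEq ι] {c : ι → ℕ} (hc : ∀ v ∈ X, c v < 2)
    (hinj : ∀ a ∈ X, ∀ b ∈ X, a ≠ b → f a ≠ f b) : Chain X 2 f (lexOn X c f) := by
  set h := lexOn X c (fun v => if c v = 0 then X.sup f - f v else f v) with hh
  have hle : ∀ a ∈ X, f a ≤ X.sup f := fun a ha => Finset.le_sup ha
  have hlt : ∀ a ∈ X, ∀ b ∈ X, (h a < h b ↔ c a < c b ∨ c a = c b ∧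
      (if c a = 0 then f b < f a else f a < f b)) := by
    intro a ha b hb
    have := hle a ha
    have := hle b hb
    rw [hh, lexOn_lt_iff ha hb]
    split_ifs <;> omega
  have hlt' : ∀ a ∈ X, ∀ b ∈ X, (lexOn X c f a < lexOn X c f b ↔ _) :=
    fun a ha b hb => lexOn_lt_iff (f := f) (c := c) ha hb
  -- Read in the order of `f`, each zero falls below and each one above all earlier points.
  have h1 : SepOn f h X := by
    refine SepOn.of_extreme hinj fun m hm => ?_
    by_cases hcm : c m = 0
    · refine .inr fun a ha ham => (hlt m hm a ha).2 ?_
      rw [if_pos hcm]; omega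
    · refine .inl fun a ha ham => (hlt a ha m hm).2 ?_
      have := hc a ha
      have := hc m hm
      split_ifs <;> omega
  have hinj' := h1.symm.injOn
  have hsub : ∀ j, X.filter (c · = j) ⊆ X := fun j => Finset.filter_subset _ _
  have h2 : SepOn h (lexOn X c f) X := by
    refine .up (A := X.filter (c · = 0)) (B := X.filter (c · = 1)) ?_ ?_ ?_ ?_ ?_
    · refine SepOn.of_extreme (fun a ha b hb => hinj' a (hsub 0 ha) b (hsub 0 hb)) fun m hm =>
        .inr fun a ha ham => ?_
      rw [hlt a (hsub 0 ha) m (hsub 0 hm)] at ham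
      rw [hlt' m (hsub 0 hm) a (hsub 0 ha)]
      rw [Finset.mem_filter] at hm ha
      rw [if_pos ha.2] at ham; omega
    · refine SepOn.of_extreme (fun a ha b hb => hinj' a (hsub 1 ha) b (hsub 1 hb)) fun m hm =>
        .inl fun a ha ham => ?_
      rw [hlt a (hsub 1 ha) m (hsub 1 hm)] at ham
      rw [hlt' a (hsub 1 ha) m (hsub 1 hm)]
      rw [Finset.mem_filter] at hm ha
      rw [if_neg (by omega)] at ham; omega
    · intro v
      simp only [Finset.mem_filter, ← and_or_left]
      exact ⟨fun hv => ⟨hv, by have := hc v hv; omega⟩, fun h => h.1⟩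
    · intro a ha b hb
      rw [hlt a (hsub 0 ha) b (hsub 1 hb)]
      rw [Finset.mem_filter] at ha hb
      omega
    · intro a ha b hb
      rw [hlt' a (hsub 0 ha) b (hsub 1 hb)]
      rw [Finset.mem_filter] at ha hb
      omega
  exact .succ h1 (single h2)

/-- Sorting stably by a colour in `{0, …, 2 ^ l - 1}` takes `2 l` separable permutations. -/
theorem color_sort [DecidableEq ι] {l : ℕ} {c : ι → ℕ} (hc : ∀ v ∈ X, c v < 2 ^ l)
    (hinj : ∀ a ∈ X, ∀ b ∈ X, a ≠ b → f a ≠ f b) : Chain X (2 * l) f (lexOn X c f) := by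
  induction l generalizing f c with
  | zero =>
    refine .zero fun a ha b hb => ?_
    rw [lexOn_lt_iff ha hb]
    have := hc a ha
    have := hc b hb
    omega
  | succ l ih =>
    -- Radix sort, lowest bit first.
    have h1 := binary_sort (f := f) (c := fun v => c v % 2) (fun v _ => Nat.mod_lt _ two_pos) hinj
    have h2 := ih (f := lexOn X (fun v => c v % 2) f) (c := fun v => c v / 2)
      (fun v hv => by have := hc v hv; rw [pow_succ] at this; omega) (h1.injOn hinj)
    have := h1.trans h2
    rw [show 2 * (l + 1) = 2 + 2 * l by ring]
    refine this.congr (OrdEq.refl _ _) fun a ha b hb => ?_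
    rw [lexOn_lt_iff ha hb, lexOn_lt_iff ha hb, lexOn_lt_iff ha hb]
    omega

end Chain

end Orders

/-! ### Translation between orders on finite sets and permutations of `Fin n` -/

section Realize

variable {ι : Type*} {f g h : ι → ℕ} {X : Finset ι} {m : ℕ}

/-- The permutation `τ` is the pattern on `X` that leads from the order of `f` to the order of
`g`; here `e` enumerates `X` in the order of `f`. -/
structure Realizes (τ : Equiv.Perm (Fin m)) (X : Finset ι) (f g : ι → ℕ) (e : Fin m → ι) :
    Prop where
  mem : ∀ v, v ∈ X ↔ ∃ i, e i = v
  mono : ∀ i j, f (e i) < f (e j) ↔ i < j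
  pattern : ∀ i j, g (e i) < g (e j) ↔ τ i < τ j

theorem Realizes.injective {τ : Equiv.Perm (Fin m)} {e : Fin m → ι} (H : Realizes τ X f g e) :
    Function.Injective e := by
  intro i j hij
  rcases lt_trichotomy i j with h | h | h
  · have := (H.mono i j).2 h; rw [hij] at this; exact absurd this (lt_irrefl _)
  · exact h
  · have := (H.mono j i).2 h; rw [hij] at this; exact absurd this (lt_irrefl _)

theorem Realizes.card {τ : Equiv.Perm (Fin m)} {e : Fin m → ι} (H : Realizes τ X f g e) :
    X.card = m := by
  have : X = Finset.univ.map ⟨e, H.injective⟩ := by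
    ext v; simp [H.mem v]
  rw [this]; simp

theorem directSum_castAdd {m n : ℕ} (σ : Equiv.Perm (Fin m)) (τ : Equiv.Perm (Fin n)) (i : Fin m) :
    directSum σ τ (Fin.castAdd n i) = Fin.castAdd n (σ i) := by
  simp [directSum]

theorem directSum_natAdd {m n : ℕ} (σ : Equiv.Perm (Fin m)) (τ : Equiv.Perm (Fin n)) (i : Fin n) :
    directSum σ τ (Fin.natAdd m i) = Fin.natAdd m (τ i) := by
  simp [directSum]

theorem skewSum_castAdd {m n : ℕ} (σ : Equiv.Perm (Fin m)) (τ : Equiv.Perm (Fin n)) (i : Fin m) :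
    (skewSum σ τ (Fin.castAdd n i) : ℕ) = n + σ i := by
  simp [skewSum, add_comm]

theorem skewSum_natAdd {m n : ℕ} (σ : Equiv.Perm (Fin m)) (τ : Equiv.Perm (Fin n)) (i : Fin n) :
    (skewSum σ τ (Fin.natAdd m i) : ℕ) = τ i := by
  simp [skewSum]

theorem SepOn.of_separable {τ : Equiv.Perm (Fin m)} (hτ : Separable τ) :
    ∀ {X : Finset ι} {e : Fin m → ι}, Realizes τ X f g e → SepOn f g X := by
  have split : ∀ {m n : ℕ} {X : Finset ι} {e : Fin (m + n) → ι} {ρ : Equiv.Perm (Fin (m + n))},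
      Realizes ρ X f g e → ∃ A B : Finset ι, (∀ v, v ∈ A ↔ ∃ i, e (Fin.castAdd n i) = v) ∧
        (∀ v, v ∈ B ↔ ∃ i, e (Fin.natAdd m i) = v) ∧ (∀ v, v ∈ X ↔ v ∈ A ∨ v ∈ B) ∧
        ∀ a ∈ A, ∀ b ∈ B, f a < f b := by
    intro m n X e ρ H
    have hA : ∀ v, v ∈ Finset.univ.map ⟨fun i => e (Fin.castAdd n i),
        H.injective.comp (Fin.castAdd_injective m n)⟩ ↔ ∃ i, e (Fin.castAdd n i) = v := by simp
    have hB : ∀ v, v ∈ Finset.univ.map ⟨fun i => e (Fin.natAdd m i),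
        H.injective.comp (Fin.natAdd_injective n m)⟩ ↔ ∃ i, e (Fin.natAdd m i) = v := by simp
    refine ⟨_, _, hA, hB, fun v => ?_, fun a ha b hb => ?_⟩
    · rw [hA, hB, H.mem]
      constructor
      · rintro ⟨i, rfl⟩
        refine Fin.addCases (fun j => .inl ⟨j, rfl⟩) (fun j => .inr ⟨j, rfl⟩) i
      · rintro (⟨i, rfl⟩ | ⟨i, rfl⟩) <;> exact ⟨_, rfl⟩
    · obtain ⟨i, rfl⟩ := (hA a).1 ha
      obtain ⟨j, rfl⟩ := (hB b).1 hb
      rw [H.mono, Fin.lt_def]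
      rw [Fin.val_castAdd, Fin.val_natAdd]
      omega
  induction hτ with
  | empty => exact fun H => .small (by rw [H.card]; simp)
  | one => exact fun H => .small (by rw [H.card])
  | @directSum m n σ τ _ _ ihσ ihτ =>
    intro X e H
    obtain ⟨A, B, hA, hB, hX, hf⟩ := split H
    refine .up (ihσ (e := fun i => e (Fin.castAdd n i)) ⟨hA, fun i j => ?_, fun i j => ?_⟩)
      (ihτ (e := fun i => e (Fin.natAdd m i)) ⟨hB, fun i j => ?_, fun i j => ?_⟩) hX hf ?_
    · simp [H.mono, Fin.lt_def, -Fin.val_fin_lt]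
    · rw [H.pattern, directSum_castAdd, directSum_castAdd]; simp [Fin.lt_def, -Fin.val_fin_lt]
    · simp [H.mono, Fin.lt_def, -Fin.val_fin_lt]
    · rw [H.pattern, directSum_natAdd, directSum_natAdd]; simp [Fin.lt_def, -Fin.val_fin_lt]
    · intro a ha b hb
      obtain ⟨i, rfl⟩ := (hA a).1 ha
      obtain ⟨j, rfl⟩ := (hB b).1 hb
      rw [H.pattern, directSum_natAdd, directSum_castAdd, Fin.lt_def]
      rw [Fin.val_castAdd, Fin.val_natAdd]
      omega
  | @skewSum m n σ τ _ _ ihσ ihτ =>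
    intro X e H
    obtain ⟨A, B, hA, hB, hX, hf⟩ := split H
    refine .down (ihσ (e := fun i => e (Fin.castAdd n i)) ⟨hA, fun i j => ?_, fun i j => ?_⟩)
      (ihτ (e := fun i => e (Fin.natAdd m i)) ⟨hB, fun i j => ?_, fun i j => ?_⟩) hX hf ?_
    · simp [H.mono, Fin.lt_def, -Fin.val_fin_lt]
    · rw [H.pattern, Fin.lt_def, skewSum_castAdd, skewSum_castAdd]
      simp [Fin.lt_def, -Fin.val_fin_lt]
    · simp [H.mono, Fin.lt_def, -Fin.val_fin_lt]
    · rw [H.pattern, Fin.lt_def, skewSum_natAdd, skewSum_natAdd]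
      simp [Fin.lt_def, -Fin.val_fin_lt]
    · intro a ha b hb
      obtain ⟨i, rfl⟩ := (hA a).1 ha
      obtain ⟨j, rfl⟩ := (hB b).1 hb
      rw [H.pattern, Fin.lt_def, skewSum_natAdd, skewSum_castAdd]
      omega

theorem SepOn.exists_realizes (H : SepOn f g X) :
    ∃ (m : ℕ) (τ : Equiv.Perm (Fin m)) (e : Fin m → ι), Separable τ ∧ Realizes τ X f g e := by
  induction H with
  | @small X h =>
    interval_cases hc : X.card
    · rw [Finset.card_eq_zero] at hc
      exact ⟨0, 1, Fin.elim0, .empty, by simp [hc], fun i => i.elim0, fun i => i.elim0⟩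
    · obtain ⟨a, rfl⟩ := Finset.card_eq_one.1 hc
      refine ⟨1, 1, fun _ => a, .one, fun v => ?_, fun i j => ?_, fun i j => ?_⟩
      · simp [eq_comm]
      · simp [Subsingleton.elim i j]
      · simp [Subsingleton.elim i j]
  | @up A B X _ _ hX hf hg ihA ihB =>
    obtain ⟨m, σ, e, hσ, He⟩ := ihA
    obtain ⟨n, τ, e', hτ, He'⟩ := ihB
    have hA : ∀ i, e i ∈ A := fun i => (He.mem _).2 ⟨i, rfl⟩
    have hB : ∀ i, e' i ∈ B := fun i => (He'.mem _).2 ⟨i, rfl⟩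
    refine ⟨m + n, directSum σ τ, Fin.append e e', .directSum hσ hτ, fun v => ?_, fun i j => ?_,
      fun i j => ?_⟩
    · rw [hX, He.mem, He'.mem]
      constructor
      · rintro (⟨i, rfl⟩ | ⟨i, rfl⟩)
        · exact ⟨Fin.castAdd n i, by simp⟩
        · exact ⟨Fin.natAdd m i, by simp⟩
      · rintro ⟨i, rfl⟩
        induction i using Fin.addCases with
        | left i => exact .inl ⟨i, by simp⟩
        | right i => exact .inr ⟨i, by simp⟩
    · induction i using Fin.addCases with
      | left i =>
        induction j using Fin.addCases with
        | left j => simp [He.mono, Fin.lt_def, -Fin.val_fin_lt]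
        | right j =>
          have := hf _ (hA i) _ (hB j)
          simp only [Fin.append_left, Fin.append_right, Fin.lt_def, Fin.val_castAdd, Fin.val_natAdd]
          omega
      | right i =>
        induction j using Fin.addCases with
        | left j =>
          have := hf _ (hA j) _ (hB i)
          simp only [Fin.append_left, Fin.append_right, Fin.lt_def, Fin.val_castAdd, Fin.val_natAdd]
          omega
        | right j => simp [He'.mono, Fin.lt_def, -Fin.val_fin_lt]
    · induction i using Fin.addCases with
      | left i =>
        induction j using Fin.addCases with
        | left j => simp [He.pattern, directSum_castAdd, Fin.lt_def, -Fin.val_fin_lt]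
        | right j =>
          have := hg _ (hA i) _ (hB j)
          simp only [Fin.append_left, Fin.append_right, Fin.lt_def, Fin.val_castAdd,
            Fin.val_natAdd, directSum_castAdd, directSum_natAdd]
          omega
      | right i =>
        induction j using Fin.addCases with
        | left j =>
          have := hg _ (hA j) _ (hB i)
          simp only [Fin.append_left, Fin.append_right, Fin.lt_def, Fin.val_castAdd,
            Fin.val_natAdd, directSum_castAdd, directSum_natAdd]
          omega
        | right j => simp [He'.pattern, directSum_natAdd, Fin.lt_def, -Fin.val_fin_lt]
  | @down A B X _ _ hX hf hg ihA ihB =>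
    obtain ⟨m, σ, e, hσ, He⟩ := ihA
    obtain ⟨n, τ, e', hτ, He'⟩ := ihB
    have hA : ∀ i, e i ∈ A := fun i => (He.mem _).2 ⟨i, rfl⟩
    have hB : ∀ i, e' i ∈ B := fun i => (He'.mem _).2 ⟨i, rfl⟩
    refine ⟨m + n, skewSum σ τ, Fin.append e e', .skewSum hσ hτ, fun v => ?_, fun i j => ?_,
      fun i j => ?_⟩
    · rw [hX, He.mem, He'.mem]
      constructor
      · rintro (⟨i, rfl⟩ | ⟨i, rfl⟩)
        · exact ⟨Fin.castAdd n i, by simp⟩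
        · exact ⟨Fin.natAdd m i, by simp⟩
      · rintro ⟨i, rfl⟩
        induction i using Fin.addCases with
        | left i => exact .inl ⟨i, by simp⟩
        | right i => exact .inr ⟨i, by simp⟩
    · induction i using Fin.addCases with
      | left i =>
        induction j using Fin.addCases with
        | left j => simp [He.mono, Fin.lt_def, -Fin.val_fin_lt]
        | right j =>
          have := hf _ (hA i) _ (hB j)
          simp only [Fin.append_left, Fin.append_right, Fin.lt_def, Fin.val_castAdd, Fin.val_natAdd]
          omega
      | right i =>
        induction j using Fin.addCases with
        | left j =>
          have := hf _ (hA j) _ (hB i)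
          simp only [Fin.append_left, Fin.append_right, Fin.lt_def, Fin.val_castAdd, Fin.val_natAdd]
          omega
        | right j => simp [He'.mono, Fin.lt_def, -Fin.val_fin_lt]
    · rw [Fin.lt_def]
      induction i using Fin.addCases with
      | left i =>
        induction j using Fin.addCases with
        | left j => simp [He.pattern, skewSum_castAdd]
        | right j =>
          have := hg _ (hA i) _ (hB j)
          rw [Fin.append_left, Fin.append_right]
          simp only [skewSum_castAdd, skewSum_natAdd]
          omega
      | right i =>
        induction j using Fin.addCases with
        | left j =>
          have := hg _ (hA j) _ (hB i)
          rw [Fin.append_left, Fin.append_right]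
          simp only [skewSum_castAdd, skewSum_natAdd]
          omega
        | right j => simp [He'.pattern, skewSum_natAdd]

theorem Chain.of_mem_pow {r : ℕ} {τ : Equiv.Perm (Fin m)} (hτ : τ ∈ separablePerms m ^ r)
    {e : Fin m → ι} (H : Realizes τ X f g e) : Chain X r f g := by
  induction r generalizing τ f e with
  | zero =>
    rw [pow_zero, Set.mem_one] at hτ
    subst hτ
    refine .zero fun a ha b hb => ?_
    obtain ⟨i, rfl⟩ := (H.mem a).1 ha
    obtain ⟨j, rfl⟩ := (H.mem b).1 hb
    rw [H.mono, H.pattern]; rfl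
  | succ r ih =>
    rw [pow_succ, Set.mem_mul] at hτ
    obtain ⟨ρ, hρ, s, hs, rfl⟩ := hτ
    -- In `ρ * s` the factor `s` acts first, so the intermediate order ranks `e i` by `s i`. The
    -- value 0 off the range of `e`, that is off `X`, plays no role.
    set h : ι → ℕ := Function.extend e (fun i => (s i : ℕ)) 0 with hh
    have he : ∀ i, h (e i) = s i := fun i => H.injective.extend_apply _ _ i
    have h1 : Realizes s X f h e := ⟨H.mem, H.mono, fun i j => by rw [he, he, Fin.lt_def]⟩
    have h2 : Realizes ρ X h g (fun i => e (s.symm i)) := by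
      refine ⟨fun v => (H.mem v).trans ⟨?_, ?_⟩, fun i j => ?_, fun i j => ?_⟩
      · rintro ⟨i, rfl⟩; exact ⟨s i, by simp⟩
      · rintro ⟨i, rfl⟩; exact ⟨_, rfl⟩
      · rw [he, he]; simp
      · rw [H.pattern]; simp
    exact .succ (SepOn.of_separable hs h1) (ih hρ h2)

end Realize

theorem exists_perm_of_injective {n : ℕ} {h : Fin n → ℕ} (hinj : Function.Injective h) :
    ∃ p : Equiv.Perm (Fin n), ∀ i j, h i < h j ↔ p i < p j := by
  set e := (Finset.univ.image h).orderIsoOfFin (k := n)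
    (by rw [Finset.card_image_of_injective _ hinj]; simp) with he
  have hm : ∀ i, h i ∈ Finset.univ.image h := fun i => Finset.mem_image_of_mem _ (Finset.mem_univ i)
  have hlt : ∀ i j, h i < h j ↔ e.symm ⟨h i, hm i⟩ < e.symm ⟨h j, hm j⟩ := by
    intro i j; rw [e.symm.lt_iff_lt]; rfl
  have hinj' : Function.Injective fun i => e.symm ⟨h i, hm i⟩ := by
    intro i j hij
    have := e.symm.injective hij
    exact hinj (Subtype.mk.inj this)
  exact ⟨Equiv.ofBijective _ (Finite.injective_iff_bijective.1 hinj'), hlt⟩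

theorem SepOn.mem_separablePerms {n : ℕ} {p q : Equiv.Perm (Fin n)}
    (H : SepOn (fun i => (p i : ℕ)) (fun i => (q i : ℕ)) Finset.univ) :
    q * p⁻¹ ∈ separablePerms n := by
  obtain ⟨m, τ, e, hτ, He⟩ := H.exists_realizes
  have hm : n = m := by rw [← He.card]; simp
  subst hm
  -- Applied to `p ∘ e` and `q ∘ e ∘ τ⁻¹`, this identifies `τ` with `q * p⁻¹`.
  have eq_one : ∀ φ : Fin n → Fin n, StrictMono φ → ∀ i, φ i = i := by
    intro φ hφ i
    have h1 : Function.Surjective φ := Finite.surjective_of_injective hφ.injective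
    have := Subsingleton.elim (hφ.orderIsoOfSurjective φ h1) (OrderIso.refl _)
    exact DFunLike.congr_fun this i
  have h1 : ∀ i, p (e i) = i := eq_one _ fun i j hij => by
    have := (He.mono i j).2 hij; rwa [← Fin.lt_def] at this
  have h2 : ∀ i, q (e (τ.symm i)) = i := eq_one _ fun i j hij => by
    have := (He.pattern (τ.symm i) (τ.symm j)).2 (by simpa using hij)
    rwa [← Fin.lt_def] at this
  have : q * p⁻¹ = τ := by
    ext i
    have h3 : p⁻¹ i = e i := by rw [Equiv.Perm.inv_eq_iff_eq, h1]
    have h4 := h2 (τ i)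
    rw [Equiv.symm_apply_apply] at h4
    rw [Equiv.Perm.mul_apply, h3, h4]
  rw [this]; exact hτ

theorem Chain.mem_pow {n r : ℕ} {p q : Equiv.Perm (Fin n)}
    (H : Chain Finset.univ r (fun i => (p i : ℕ)) (fun i => (q i : ℕ))) :
    q * p⁻¹ ∈ separablePerms n ^ r := by
  induction r generalizing p with
  | zero =>
    cases H with
    | zero h =>
      have : SepOn (fun i => (p i : ℕ)) (fun i => (q i : ℕ)) Finset.univ :=
        (SepOn.refl (f := fun i => (p i : ℕ)) fun a _ b _ hab => by
          simpa [Fin.val_inj] using hab).congr (OrdEq.refl _ _) h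
      have hqp : ∀ i j, p i < p j ↔ q i < q j := fun i j =>
        h i (Finset.mem_univ _) j (Finset.mem_univ _)
      have h1 : StrictMono fun i => q (p.symm i) := fun i j hij => (hqp _ _).1 (by simpa using hij)
      have h2 := Subsingleton.elim (h1.orderIsoOfSurjective _
        (q.surjective.comp p.symm.surjective)) (OrderIso.refl _)
      rw [pow_zero, Set.mem_one]
      ext i
      exact congrArg Fin.val (DFunLike.congr_fun h2 i)
  | succ r ih =>
    cases H with
    | @succ _ _ h _ h1 h2 =>
      -- The intermediate order is injective, so a permutation can replace it, as the induction
      -- requires.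
      obtain ⟨s, hs⟩ := exists_perm_of_injective (h := h) fun a b hab => by
        by_contra hne
        exact h1.symm.injOn a (Finset.mem_univ _) b (Finset.mem_univ _) hne hab
      have hs' : OrdEq Finset.univ h (fun i => (s i : ℕ)) := fun i _ j _ => by
        rw [hs, Fin.lt_def]
      have h3 := (h1.congr (OrdEq.refl _ _) hs').mem_separablePerms
      have h4 := ih (h2.congr hs' (OrdEq.refl _ _))
      rw [pow_succ]
      refine Set.mem_mul.2 ⟨_, h4, _, h3, ?_⟩
      group

/-! ### Two constructions of almost mixed minors, and interval colouring -/

section Minors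

variable {n k : ℕ}

/-- Every cell off the diagonal of the division given by `ρ` (rows) and `γ` (columns) is mixed. -/
def MixedOffDiag {n : ℕ} (k : ℕ) (g : Fin n → ℕ) (ρ γ : Fin n → ℕ) : Prop :=
  ∀ i < k, ∀ j < k, i ≠ j →
    (∃ x y y', ρ x = i ∧ γ y = j ∧ γ y' = j ∧ g x < g y ∧ ¬ g x < g y') ∧
    (∃ x x' y, ρ x = i ∧ ρ x' = i ∧ γ y = j ∧ g x < g y ∧ ¬ g x' < g y)

/-- A `k`-almost mixed minor whose divisions are given by monotone maps to `{0, …, k - 1}`. -/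
def HasMonoMinor {n : ℕ} (k : ℕ) (g : Fin n → ℕ) : Prop :=
  ∃ ρ γ : Fin n → ℕ, Monotone ρ ∧ Monotone γ ∧ (∀ v, ρ v < k) ∧ (∀ v, γ v < k) ∧
    MixedOffDiag k g ρ γ

theorem adjMatrix_eq_iff {σ : Equiv.Perm (Fin n)} {x y x' y' : Fin n} :
    adjMatrix σ x y = adjMatrix σ x' y' ↔ (σ x < σ y ↔ σ x' < σ y') := by
  unfold adjMatrix
  simp only [Matrix.of_apply]
  by_cases h : σ x < σ y <;> by_cases h' : σ x' < σ y' <;> simp [h, h']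

/-- The interval partition given by the fibres of a monotone map. -/
def IntervalPartition.ofMonotone {ρ : Fin n → ℕ} (hρ : Monotone ρ) (hlt : ∀ v, ρ v < k)
    (hne : ∀ i : Fin k, ∃ v, ρ v = i) : IntervalPartition (Fin n) k where
  part i := {v | ρ v = i}
  nonempty i := hne i
  cover x := ⟨⟨ρ x, hlt x⟩, rfl⟩
  ordConnected i := ⟨fun _ hx _ hy _ hz => le_antisymm ((hρ hz.2).trans (le_of_eq hy))
    ((le_of_eq (Eq.symm hx)).trans (hρ hz.1))⟩
  lt_of_lt i j hij x hx y hy := by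
    by_contra h
    have h1 := hρ (not_lt.1 h)
    rw [hx, hy] at h1
    exact absurd hij (not_lt.2 h1)

/-- For `2 ≤ k` each part meets some mixed cell off the diagonal, which makes it nonempty. -/
theorem HasMonoMinor.hasAlmostMixedMinor {σ : Equiv.Perm (Fin n)} (hk : 2 ≤ k)
    (H : HasMonoMinor k (fun i => (σ i : ℕ))) : HasAlmostMixedMinor k (adjMatrix σ) := by
  obtain ⟨ρ, γ, hρ, hγ, hρk, hγk, hm⟩ := H
  have hother : ∀ i : Fin k, ∃ j : Fin k, i ≠ j := by
    intro i
    by_cases h : (i : ℕ) = 0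
    · exact ⟨⟨1, by omega⟩, fun e => by rw [e] at h; simp at h⟩
    · exact ⟨⟨0, by omega⟩, fun e => h (by rw [e])⟩
  have hρne : ∀ i : Fin k, ∃ v, ρ v = i := by
    intro i
    obtain ⟨j, hij⟩ := hother i
    obtain ⟨x, -, -, hx, -⟩ := (hm i i.2 j j.2 (Fin.val_ne_of_ne hij)).1
    exact ⟨x, hx⟩
  have hγne : ∀ i : Fin k, ∃ v, γ v = i := by
    intro i
    obtain ⟨j, hij⟩ := hother i
    obtain ⟨-, x, -, -, hx, -⟩ := (hm j j.2 i i.2 (Fin.val_ne_of_ne hij.symm)).1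
    exact ⟨x, hx⟩
  refine ⟨.ofMonotone hρ hρk hρne, .ofMonotone hγ hγk hγne, fun i j hij =>
    ⟨fun h => ?_, fun h => ?_⟩⟩
  · obtain ⟨x, y, y', hx, hy, hy', h1, h2⟩ := (hm i i.2 j j.2 (Fin.val_ne_of_ne hij)).1
    have := h ⟨x, hx⟩ ⟨y, hy⟩ ⟨y', hy'⟩
    rw [cell, Matrix.submatrix_apply, Matrix.submatrix_apply, adjMatrix_eq_iff] at this
    exact h2 (this.1 h1)
  · obtain ⟨x, x', y, hx, hx', hy, h1, h2⟩ := (hm i i.2 j j.2 (Fin.val_ne_of_ne hij)).2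
    have := h ⟨x, hx⟩ ⟨x', hx'⟩ ⟨y, hy⟩
    rw [cell, Matrix.submatrix_apply, Matrix.submatrix_apply, adjMatrix_eq_iff] at this
    exact h2 (this.1 h1)

theorem IntervalPartition.exists_monotone (P : IntervalPartition (Fin n) k) :
    ∃ ρ : Fin n → ℕ, Monotone ρ ∧ (∀ v, ρ v < k) ∧ (∀ (i : Fin k), ∃ v, ρ v = i) ∧
      ∀ (i : Fin k) v, v ∈ P.part i ↔ ρ v = i := by
  choose φ hφ using P.cover
  have huniq : ∀ v i, v ∈ P.part i → φ v = i := by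
    intro v i hv
    rcases lt_trichotomy (φ v) i with h | h | h
    · exact absurd (P.lt_of_lt _ _ h v (hφ v) v hv) (lt_irrefl _)
    · exact h
    · exact absurd (P.lt_of_lt _ _ h v hv v (hφ v)) (lt_irrefl _)
  refine ⟨fun v => φ v, fun v w hvw => ?_, fun v => (φ v).2, fun i => ?_, fun i v => ⟨fun h => ?_,
    fun h => ?_⟩⟩
  · by_contra h
    exact absurd (P.lt_of_lt _ _ (not_le.1 h) w (hφ w) v (hφ v)) (not_lt.2 hvw)
  · obtain ⟨v, hv⟩ := P.nonempty i
    exact ⟨v, congrArg Fin.val (huniq v i hv)⟩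
  · exact congrArg Fin.val (huniq v i h)
  · rw [← Fin.ext h]; exact hφ v

theorem HasAlmostMixedMinor.exists_monotone {τ : Equiv.Perm (Fin n)}
    (H : HasAlmostMixedMinor k (adjMatrix τ)) : ∃ ρ γ : Fin n → ℕ, Monotone ρ ∧ Monotone γ ∧
      (∀ v, ρ v < k) ∧ (∀ v, γ v < k) ∧ MixedOffDiag k (fun i => (τ i : ℕ)) ρ γ := by
  obtain ⟨R, C, h⟩ := H
  obtain ⟨ρ, hρ, hρk, hρne, hR⟩ := R.exists_monotone
  obtain ⟨γ, hγ, hγk, hγne, hC⟩ := C.exists_monotone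
  refine ⟨ρ, γ, hρ, hγ, hρk, hγk, fun i hi j hj hij => ?_⟩
  obtain ⟨h1, h2⟩ := h ⟨i, hi⟩ ⟨j, hj⟩ (fun e => hij (Fin.mk.inj e))
  constructor
  · unfold IsHorizontal at h1
    push Not at h1
    obtain ⟨⟨x, hx⟩, ⟨y, hy⟩, ⟨y', hy'⟩, h1⟩ := h1
    rw [cell, Matrix.submatrix_apply, Matrix.submatrix_apply, Ne, adjMatrix_eq_iff] at h1
    rw [hR] at hx
    rw [hC] at hy hy'
    by_cases h3 : τ x < τ y
    · exact ⟨x, y, y', hx, hy, hy', h3, fun h4 => h1 (iff_of_true h3 h4)⟩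
    · refine ⟨x, y', y, hx, hy', hy, ?_, h3⟩
      by_contra h4
      exact h1 (iff_of_false h3 h4)
  · unfold IsVertical at h2
    push Not at h2
    obtain ⟨⟨x, hx⟩, ⟨x', hx'⟩, ⟨y, hy⟩, h1⟩ := h2
    rw [cell, Matrix.submatrix_apply, Matrix.submatrix_apply, Ne, adjMatrix_eq_iff] at h1
    rw [hR] at hx hx'
    rw [hC] at hy
    by_cases h3 : τ x < τ y
    · exact ⟨x, x', y, hx, hx', hy, h3, fun h4 => h1 (iff_of_true h3 h4)⟩
    · refine ⟨x', x, y, hx', hx, hy, ?_, h3⟩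
      by_contra h4
      exact h1 (iff_of_false h3 h4)

/-- `k` consecutive intervals give an almost mixed minor, if they contain points `lo`, `hi` whose
values enclose a common level, and a point `u` beyond all of these. -/
theorem hasMonoMinor_of_common_level {g : Fin n → ℕ} (hg : Function.Injective g)
    (hk : 0 < k) {T : Finset (Fin n)} (hT : T.card = k) {lo hi u : Fin n → Fin n} {p : ℕ}
    (hlo : ∀ e ∈ T, e ≤ lo e ∧ ∀ e' ∈ T, e < e' → lo e < e')
    (hhi : ∀ e ∈ T, e ≤ hi e ∧ ∀ e' ∈ T, e < e' → hi e < e')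
    (hu : ∀ e ∈ T, e ≤ u e ∧ ∀ e' ∈ T, e < e' → u e < e')
    (hp : ∀ e ∈ T, g (lo e) ≤ p ∧ p ≤ g (hi e))
    (hext : ∀ e ∈ T, (∀ e' ∈ T, g (hi e') < g (u e)) ∨ (∀ e' ∈ T, g (u e) < g (lo e'))) :
    HasMonoMinor k g := by
  -- The index of the last point of `T` that is at most `v`; truncated subtraction puts everything
  -- before `T` into part 0.
  set ρ : Fin n → ℕ := fun v => (T.filter (· ≤ v)).card - 1 with hρ
  have hmono : Monotone ρ := fun v w hvw => Nat.sub_le_sub_right (Finset.card_le_card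
    (Finset.monotone_filter_right _ fun e _ he => le_trans he hvw)) 1
  have hlt : ∀ v, ρ v < k := fun v => by
    have := Finset.card_filter_le T (· ≤ v)
    simp only [hρ]; omega
  have hsame : ∀ e ∈ T, ∀ w, (e ≤ w ∧ ∀ e' ∈ T, e < e' → w < e') → ρ w = ρ e := by
    rintro e he w ⟨h1, h2⟩
    simp only [hρ]
    congr 2
    refine Finset.filter_congr fun e' he' => ⟨fun h => ?_, fun h => h.trans h1⟩
    by_contra h3
    exact absurd (h2 e' he' (not_le.1 h3)) (not_lt.2 h)
  have hinj : ∀ e ∈ T, ∀ e' ∈ T, e < e' → ρ e < ρ e' := by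
    intro e he e' he' hlt
    have h1 : 0 < (T.filter (· ≤ e)).card := Finset.card_pos.2 ⟨e, by simp [he]⟩
    have h2 : (T.filter (· ≤ e)).card < (T.filter (· ≤ e')).card := by
      refine Finset.card_lt_card (Finset.ssubset_iff_of_subset
        (Finset.monotone_filter_right _ fun v _ hv => le_trans hv hlt.le) |>.2 ⟨e', ?_, ?_⟩)
      · simp [he']
      · simp [hlt]
    simp only [hρ]; omega
  have hsurj : ∀ i < k, ∃ e ∈ T, ρ e = i := by
    intro i hi
    have himg : T.image ρ = Finset.range k := by
      refine Finset.eq_of_subset_of_card_le (fun i hi => ?_) ?_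
      · obtain ⟨e, -, rfl⟩ := Finset.mem_image.1 hi
        exact Finset.mem_range.2 (hlt e)
      · rw [Finset.card_range, Finset.card_image_of_injOn, hT]
        intro e he e' he' hee
        rcases lt_trichotomy e e' with h | h | h
        · exact absurd hee (hinj e he e' he' h).ne
        · exact h
        · exact absurd hee (hinj e' he' e he h).ne'
    have := Finset.mem_range.2 hi
    rw [← himg] at this
    simpa using this
  -- As both ranges contain `p`, either an end of the range of `e` falls inside that of `e'`, or the
  -- range of `e` encloses it. In the latter case `u e'` lies beyond the range of `e` and takes over
  -- as an end of the part of `e'`.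
  have key : ∀ e ∈ T, ∀ e' ∈ T, e ≠ e' → ∃ x y' y, ρ x = ρ e ∧ ρ y' = ρ e' ∧ ρ y = ρ e' ∧
      g y' < g x ∧ g x < g y := by
    intro e he e' he' hne
    have r1 := hsame e he _ (hlo e he)
    have r2 := hsame e he _ (hhi e he)
    have s1 := hsame e' he' _ (hlo e' he')
    have s2 := hsame e' he' _ (hhi e' he')
    have s3 := hsame e' he' _ (hu e' he')
    have hρne : ρ e ≠ ρ e' := by
      rcases lt_or_gt_of_ne hne with h | h
      · exact (hinj e he e' he' h).ne
      · exact (hinj e' he' e he h).ne'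
    have hd : ∀ a b, ρ a = ρ e → ρ b = ρ e' → g a ≠ g b := by
      intro a b ha hb hab
      rw [hg hab, hb] at ha
      exact hρne ha.symm
    have d1 := hd _ _ r1 s1
    have d2 := hd _ _ r1 s2
    have d3 := hd _ _ r2 s1
    have d4 := hd _ _ r2 s2
    have p1 := hp e he
    have p2 := hp e' he'
    by_cases c1 : g (lo e') < g (lo e)
    · exact ⟨lo e, lo e', hi e', r1, s1, s2, c1, by omega⟩
    by_cases c2 : g (hi e) < g (hi e')
    · exact ⟨hi e, lo e', hi e', r2, s1, s2, by omega, c2⟩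
    rcases hext e' he' with h | h
    · exact ⟨hi e, lo e', u e', r2, s1, s3, by omega, h e he⟩
    · exact ⟨lo e, u e', hi e', r1, s3, s2, h e he, by omega⟩
  -- One division serves for rows and columns: `key` at (e, e') gives a nonconstant row, `key` at
  -- (e', e) a nonconstant column.
  refine ⟨ρ, ρ, hmono, hmono, hlt, hlt, fun i hi j hj hij => ?_⟩
  obtain ⟨e, he, rfl⟩ := hsurj i hi
  obtain ⟨e', he', rfl⟩ := hsurj j hj
  have hne : e ≠ e' := by rintro rfl; exact hij rfl
  constructor
  · obtain ⟨x, y', y, hx, hy', hy, h1, h2⟩ := key e he e' he' hne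
    exact ⟨x, y, y', hx, hy, hy', h2, by omega⟩
  · obtain ⟨y, x, x', hy, hx, hx', h1, h2⟩ := key e' he' e he hne.symm
    exact ⟨x, x', y, hx, hx', hy, h1, by omega⟩

/-- The point `d` of `S` separates the values at `u` and `v`. -/
def Split (g : Fin n → ℕ) (S : Finset (Fin n)) (u v : Fin n) : Prop :=
  ∃ d ∈ S, (g u < g d ∧ g d < g v) ∨ (g v < g d ∧ g d < g u)

/-- Patterns whose intervals are all split by the points on one side are covered by the
hypothesis on `k - 1`. -/
theorem chain_of_split {r : ℕ} {g : Fin n → ℕ} (hk : 2 ≤ k) (hg : Function.Injective g)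
    (hfree : ¬ HasMonoMinor k g)
    (hyp : ∀ m : ℕ, almostMixedFreePerms (k - 1) m ⊆ separablePerms m ^ r)
    {x S E : Finset (Fin n)} {a : Fin n} (hEx : E ⊆ x)
    (hside : (∀ d, d ∈ S ∨ d = a → ∀ v ∈ x, d < v) ∨ (∀ d, d ∈ S ∨ d = a → ∀ v ∈ x, v < d))
    (hext : (∀ v ∈ x, g a < g v) ∨ (∀ v ∈ x, g v < g a))
    (hsplit : ∀ e ∈ E, ∀ e' ∈ E, e < e' → ∃ u ∈ x, ∃ u' ∈ x, e ≤ u ∧ u ≤ e' ∧ e ≤ u' ∧ u' ≤ e' ∧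
      Split g S u u') : Chain E r (fun i => (i : ℕ)) g := by
  by_cases hcard : E.card ≤ 1
  · exact Chain.of_card_le_one hcard _ _ _
  obtain ⟨m, hm⟩ : ∃ m, E.card = m := ⟨_, rfl⟩
  set e := E.orderEmbOfFin hm with he
  have heE : ∀ i, e i ∈ E := fun i => Finset.orderEmbOfFin_mem E hm i
  obtain ⟨τ, hτ⟩ := exists_perm_of_injective (h := fun i => g (e i)) (hg.comp e.injective)
  have hreal : Realizes τ E (fun i => (i : ℕ)) g e := by
    refine ⟨fun v => ?_, fun i j => ?_, hτ⟩
    · have := Finset.range_orderEmbOfFin E hm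
      rw [← Finset.mem_coe, ← this]; rfl
    · rw [← Fin.lt_def, e.lt_iff_lt]
  refine Chain.of_mem_pow (hyp m ?_) hreal
  -- A minor of the pattern would extend to a k-minor of `g`, with `S` and `a` in one additional
  -- part at the front or at the end.
  intro hminor
  obtain ⟨ρ, γ, hρ, hγ, hρk, hγk, hmix⟩ := hminor.exists_monotone
  -- Here `t` is the index of the additional part and `φ` renumbers the old parts around it.
  have hat : ∃ (t : ℕ) (φ : ℕ → ℕ), (∀ i < k, i ≠ t → ∃ i' < k - 1, φ i' = i) ∧
      ∀ ρ : Fin n → ℕ, Monotone ρ → (∀ v, ρ v < k - 1) → ∃ ρ' : Fin n → ℕ, Monotone ρ' ∧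
        (∀ v, ρ' v < k) ∧ (∀ d, d ∈ S ∨ d = a → ρ' d = t) ∧ ∀ v ∈ x, ρ' v = φ (ρ v) := by
    classical
    rcases hside with hside | hside
    · refine ⟨0, fun i => i + 1, fun i hi hi0 => ⟨i - 1, by omega, by dsimp only; omega⟩,
        fun ρ hρ hρk => ⟨fun v => if ∀ w ∈ x, v < w then 0 else ρ v + 1, fun v w hvw => ?_,
          fun v => ?_, fun d hd => if_pos (hside d hd), fun v hv => if_neg fun h =>
            absurd (h v hv) (lt_irrefl _)⟩⟩
      · dsimp only
        split_ifs with h1 h2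
        · exact le_rfl
        · exact Nat.zero_le _
        · exact absurd (fun z hz => lt_of_le_of_lt hvw (by rename_i h2; exact h2 z hz)) h1
        · exact Nat.succ_le_succ (hρ hvw)
      · have := hρk v
        dsimp only
        split_ifs <;> omega
    · refine ⟨k - 1, fun i => i, fun i hi hi0 => ⟨i, by omega, rfl⟩,
        fun ρ hρ hρk => ⟨fun v => if ∀ w ∈ x, w < v then k - 1 else ρ v, fun v w hvw => ?_,
          fun v => ?_, fun d hd => if_pos (hside d hd), fun v hv => if_neg fun h =>
            absurd (h v hv) (lt_irrefl _)⟩⟩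
      · have := hρk v
        dsimp only
        split_ifs with h1 h2
        · exact le_rfl
        · exact absurd (fun z hz => lt_of_lt_of_le (h1 z hz) hvw) h2
        · exact this.le
        · exact hρ hvw
      · have := hρk v
        dsimp only
        split_ifs <;> omega
  obtain ⟨t, φ, hφ, hat⟩ := hat
  -- The division of `E` extends as a step function, so the split points between two points of `E`
  -- in one part stay in that part, even if they are not in `E`.
  have hext' : ∀ ρ : Fin m → ℕ, Monotone ρ → (∀ v, ρ v < k - 1) → ∃ ρ' : Fin n → ℕ, Monotone ρ' ∧
      (∀ v, ρ' v < k - 1) ∧ ∀ i j, ρ i = ρ j → ∀ v, e i ≤ v → v ≤ e j → ρ' v = ρ i := by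
    intro ρ hρ hρk
    refine ⟨fun v => (Finset.univ.filter (e · ≤ v)).sup ρ, fun v w hvw => ?_, fun v => ?_,
      fun i j hij v hi hj => le_antisymm (Finset.sup_le fun i' hi' => ?_) ?_⟩
    · exact Finset.sup_mono (Finset.monotone_filter_right _ fun i _ hi => le_trans hi hvw)
    · exact (Finset.sup_lt_iff (by simp; omega)).2 fun i _ => hρk i
    · rw [hij]
      exact hρ (e.le_iff_le.1 ((Finset.mem_filter.1 hi').2.trans hj))
    · exact Finset.le_sup (f := ρ) (by simp [hi])
  obtain ⟨ρ₁, hρ₁, hρ₁k, hρ₁e⟩ := hext' ρ hρ hρk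
  obtain ⟨γ₁, hγ₁, hγ₁k, hγ₁e⟩ := hext' γ hγ hγk
  obtain ⟨ρ₂, hρ₂, hρ₂k, hρ₂t, hρ₂x⟩ := hat ρ₁ hρ₁ hρ₁k
  obtain ⟨γ₂, hγ₂, hγ₂k, hγ₂t, hγ₂x⟩ := hat γ₁ hγ₁ hγ₁k
  have hex : ∀ i, e i ∈ x := fun i => hEx (heE i)
  have h2 : 2 ≤ m := by omega
  have hother : ∀ i < k - 1, k - 1 = 1 ∨ ∃ j < k - 1, i ≠ j := by
    intro i hi
    by_cases h1 : k - 1 = 1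
    · exact .inl h1
    by_cases h0 : i = 0
    · exact .inr ⟨1, by omega, by omega⟩
    · exact .inr ⟨0, by omega, h0⟩
  -- A mixed cell forces two points into each of its parts. If `k - 1 = 1` there is no cell off the
  -- diagonal, but the only part then contains all `m ≥ 2` points.
  have two : ∀ ρ₀ : Fin m → ℕ, (∀ v, ρ₀ v < k - 1) →
      (∀ i < k - 1, (∃ j < k - 1, i ≠ j) → ∃ p q, p ≠ q ∧ ρ₀ p = i ∧ ρ₀ q = i) →
      ∀ i < k - 1, ∃ p q, p < q ∧ ρ₀ p = i ∧ ρ₀ q = i := by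
    intro ρ₀ hlt h i hi
    rcases hother i hi with h1 | h1
    · have a0 := hlt ⟨0, by omega⟩
      have a1 := hlt ⟨1, by omega⟩
      exact ⟨⟨0, by omega⟩, ⟨1, by omega⟩, by simp [Fin.lt_def], by omega, by omega⟩
    · obtain ⟨p, q, hpq, hp, hq⟩ := h i hi h1
      rcases lt_or_gt_of_ne hpq with h | h
      · exact ⟨p, q, h, hp, hq⟩
      · exact ⟨q, p, h, hq, hp⟩
  have twoρ := two ρ hρk fun i hi ⟨j, hj, hij⟩ => by
    obtain ⟨p, q, y, hp, hq, -, h1, h2⟩ := (hmix i hi j hj hij).2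
    exact ⟨p, q, by rintro rfl; exact h2 h1, hp, hq⟩
  have twoγ := two γ hγk fun i hi ⟨j, hj, hij⟩ => by
    obtain ⟨y, p, q, -, hp, hq, h1, h2⟩ := (hmix j hj i hi hij.symm).1
    exact ⟨p, q, by rintro rfl; exact h2 h1, hp, hq⟩
  have splitpair : ∀ (ρ₀ : Fin m → ℕ) (ρ' ρ'' : Fin n → ℕ), (∀ i < k - 1, ∃ p q, p < q ∧
      ρ₀ p = i ∧ ρ₀ q = i) → (∀ i j, ρ₀ i = ρ₀ j → ∀ v, e i ≤ v → v ≤ e j → ρ' v = ρ₀ i) →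
      (∀ v ∈ x, ρ'' v = φ (ρ' v)) → ∀ i < k - 1, ∃ u ∈ x, ∃ u' ∈ x, ρ'' u = φ i ∧ ρ'' u' = φ i ∧
        ∃ d ∈ S, g u < g d ∧ g d < g u' := by
    intro ρ₀ ρ' ρ'' h1 h2 h3 i hi
    obtain ⟨p, q, hpq, hp, hq⟩ := h1 i hi
    obtain ⟨u, hu, u', hu', l1, l2, l3, l4, d, hd, hs⟩ :=
      hsplit _ (heE p) _ (heE q) (e.lt_iff_lt.2 hpq)
    have m1 : ρ'' u = φ i := by rw [h3 u hu, h2 p q (hp.trans hq.symm) u l1 l2, hp]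
    have m2 : ρ'' u' = φ i := by rw [h3 u' hu', h2 p q (hp.trans hq.symm) u' l3 l4, hp]
    rcases hs with hs | hs
    · exact ⟨u, hu, u', hu', m1, m2, d, hd, hs⟩
    · exact ⟨u', hu', u, hu, m2, m1, d, hd, hs⟩
  have splitρ := splitpair ρ ρ₁ ρ₂ twoρ hρ₁e hρ₂x
  have splitγ := splitpair γ γ₁ γ₂ twoγ hγ₁e hγ₂x
  have hρφ : ∀ i, ρ₂ (e i) = φ (ρ i) := fun i => by
    rw [hρ₂x _ (hex i), hρ₁e i i rfl _ le_rfl le_rfl]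
  have hγφ : ∀ i, γ₂ (e i) = φ (γ i) := fun i => by
    rw [hγ₂x _ (hex i), hγ₁e i i rfl _ le_rfl le_rfl]
  have hρa := hρ₂t a (.inr rfl)
  have hγa := hγ₂t a (.inr rfl)
  refine hfree ⟨ρ₂, γ₂, hρ₂, hγ₂, hρ₂k, hγ₂k, fun i hi j hj hij => ?_⟩
  -- In a cell with the additional part, `d` separates `u` from `u'`, and the extreme point `a` lies
  -- opposite to `d` with respect to one of them: one observation per direction of mixing.
  by_cases hit : i = t
  · obtain ⟨j', hj', rfl⟩ := hφ j hj (by rw [← hit]; exact hij.symm)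
    obtain ⟨u, hu, u', hu', r1, r2, d, hd, s1, s2⟩ := splitγ j' hj'
    have hdt := hρ₂t d (.inl hd)
    subst hit
    refine ⟨⟨d, u', u, hdt, r2, r1, s2, by omega⟩, ?_⟩
    rcases hext with h | h
    · exact ⟨a, d, u, hρa, hdt, r1, h u hu, by omega⟩
    · have := h u' hu'
      exact ⟨d, a, u', hdt, hρa, r2, s2, by omega⟩
  obtain ⟨i', hi', rfl⟩ := hφ i hi hit
  by_cases hjt : j = t
  · obtain ⟨u, hu, u', hu', r1, r2, d, hd, s1, s2⟩ := splitρ i' hi'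
    have hdt := hγ₂t d (.inl hd)
    subst hjt
    refine ⟨?_, ⟨u, u', d, r1, r2, hdt, s1, by omega⟩⟩
    rcases hext with h | h
    · have := h u hu
      exact ⟨u, d, a, r1, hdt, hγa, s1, by omega⟩
    · exact ⟨u', a, d, r2, hγa, hdt, h u' hu', by omega⟩
  obtain ⟨j', hj', rfl⟩ := hφ j hj hjt
  obtain ⟨⟨p, q, q', hp, hq, hq', h1, h2⟩, ⟨s, s', z, hs, hs', hz, h3, h4⟩⟩ :=
    hmix i' hi' j' hj' (by rintro rfl; exact hij rfl)
  refine ⟨⟨e p, e q, e q', by rw [hρφ, hp], by rw [hγφ, hq], by rw [hγφ, hq'], ?_, ?_⟩,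
    ⟨e s, e s', e z, by rw [hρφ, hs], by rw [hρφ, hs'], by rw [hγφ, hz], ?_, ?_⟩⟩
  · exact (hτ p q).2 h1
  · exact fun h => h2 ((hτ p q').1 h)
  · exact (hτ s z).2 h3
  · exact fun h => h4 ((hτ s' z).1 h)

/-- An interval graph without `k`-cliques is `k`-colourable. -/
theorem exists_interval_coloring {ι : Type*} [DecidableEq ι] (I : Finset ι) (m M : ι → ℕ)
    (hk : ∀ T ⊆ I, ∀ p, (∀ i ∈ T, m i ≤ p ∧ p ≤ M i) → T.card < k) (hle : ∀ i ∈ I, m i ≤ M i) :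
    ∃ c : ι → ℕ, (∀ i ∈ I, c i < k) ∧
      ∀ i ∈ I, ∀ j ∈ I, i ≠ j → c i = c j → M i < m j ∨ M j < m i := by
  revert hk hle
  refine Finset.induction_on_max_value (motive := fun I =>
    (∀ T ⊆ I, ∀ p, (∀ i ∈ T, m i ≤ p ∧ p ≤ M i) → T.card < k) → (∀ i ∈ I, m i ≤ M i) →
    ∃ c : ι → ℕ, (∀ i ∈ I, c i < k) ∧
      ∀ i ∈ I, ∀ j ∈ I, i ≠ j → c i = c j → M i < m j ∨ M j < m i) m I
    (fun _ _ => ⟨0, by simp, by simp⟩) ?_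
  intro z s hz hmax ih hk hle
  obtain ⟨c, hc, hcol⟩ := ih (fun T hT => hk T (hT.trans (Finset.subset_insert _ _)))
    (fun i hi => hle i (Finset.mem_insert_of_mem hi))
  -- Greedy colouring by left ends: the earlier intervals that meet `z` all contain `m z`, so there
  -- are fewer than `k` of them and a colour is free.
  set J := s.filter (fun j => m z ≤ M j) with hJ
  have hJk : J.card < k := hk J ((Finset.filter_subset _ _).trans (Finset.subset_insert _ _)) (m z)
    fun i hi => ⟨hmax i (Finset.mem_filter.1 hi).1, (Finset.mem_filter.1 hi).2⟩
  obtain ⟨q, hq, hqJ⟩ : ∃ q ∈ Finset.range k, q ∉ J.image c := by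
    apply Finset.exists_mem_notMem_of_card_lt_card
    rw [Finset.card_range]
    exact lt_of_le_of_lt Finset.card_image_le hJk
  have hne : ∀ i ∈ s, i ≠ z := by rintro i hi rfl; exact hz hi
  have hnew : ∀ i ∈ s, c i = q → M i < m z := by
    intro i hi hiq
    by_contra h
    exact hqJ (Finset.mem_image.2 ⟨i, Finset.mem_filter.2 ⟨hi, not_lt.1 h⟩, hiq⟩)
  refine ⟨Function.update c z q, fun i hi => ?_, fun i hi j hj hij hc' => ?_⟩
  · rcases Finset.mem_insert.1 hi with rfl | hi
    · simpa using hq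
    · rw [Function.update_of_ne (hne i hi)]; exact hc i hi
  · rcases Finset.mem_insert.1 hi with rfl | hi' <;> rcases Finset.mem_insert.1 hj with rfl | hj'
    · exact absurd rfl hij
    · rw [Function.update_self, Function.update_of_ne (hne j hj')] at hc'
      exact .inr (hnew j hj' hc'.symm)
    · rw [Function.update_self, Function.update_of_ne (hne i hi')] at hc'
      exact .inl (hnew i hi' hc')
    · rw [Function.update_of_ne (hne i hi'), Function.update_of_ne (hne j hj')] at hc'
      exact hcol i hi' j hj' hij hc'

end Minors

/-! ### Points split by a set, and maximal unsplit intervals -/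

section Splitting

variable {n : ℕ} {g : Fin n → ℕ} {S : Finset (Fin n)} {u v w d : Fin n}

theorem Split.symm (h : Split g S u v) : Split g S v u := by
  obtain ⟨d, hd, h⟩ := h
  exact ⟨d, hd, h.symm⟩

theorem not_split_self (g : Fin n → ℕ) (S : Finset (Fin n)) (u : Fin n) : ¬ Split g S u u := by
  rintro ⟨d, -, h⟩; omega

theorem lt_iff_of_not_split (hg : Function.Injective g) (h : ¬ Split g S u v) (hd : d ∈ S)
    (hu : u ∉ S) (hv : v ∉ S) : g u < g d ↔ g v < g d := by
  have h1 : g u ≠ g d := fun e => hu (by rwa [hg e])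
  have h2 : g v ≠ g d := fun e => hv (by rwa [hg e])
  have h3 : ¬ ((g u < g d ∧ g d < g v) ∨ (g v < g d ∧ g d < g u)) := fun h' => h ⟨d, hd, h'⟩
  omega

/-- A `v` in `S` could itself separate `u` from `w` without separating it from either, hence the
condition `v ∉ S`. -/
theorem not_split_trans (hg : Function.Injective g) (hv : v ∉ S) (h1 : ¬ Split g S u v)
    (h2 : ¬ Split g S v w) : ¬ Split g S u w := by
  rintro ⟨d, hd, h⟩
  have h3 : g v ≠ g d := fun e => hv (by rwa [hg e])
  have h4 : ¬ ((g u < g d ∧ g d < g v) ∨ (g v < g d ∧ g d < g u)) := fun h' => h1 ⟨d, hd, h'⟩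
  have h5 : ¬ ((g v < g d ∧ g d < g w) ∨ (g w < g d ∧ g d < g v)) := fun h' => h2 ⟨d, hd, h'⟩
  omega

open Classical in
/-- The first point of the maximal interval of `x` that contains `v` and is not split by `S`. -/
noncomputable def blockStart (g : Fin n → ℕ) (S x : Finset (Fin n)) (v : Fin n) : Fin n :=
  (insert v (x.filter fun u => u ≤ v ∧ ∀ w ∈ x, u ≤ w → w ≤ v → ¬ Split g S w v)).min'
    (Finset.insert_nonempty _ _)

variable {x : Finset (Fin n)}

theorem blockStart_spec (hv : v ∈ x) : blockStart g S x v ∈ x ∧ blockStart g S x v ≤ v ∧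
    ∀ w ∈ x, blockStart g S x v ≤ w → w ≤ v → ¬ Split g S w v := by
  classical
  have h := Finset.min'_mem (insert v (x.filter fun u => u ≤ v ∧
    ∀ w ∈ x, u ≤ w → w ≤ v → ¬ Split g S w v)) (Finset.insert_nonempty _ _)
  have h' : blockStart g S x v ∈ _ := h
  rcases Finset.mem_insert.1 h' with h1 | h1
  · rw [h1]
    refine ⟨hv, le_rfl, fun w _ h2 h3 => ?_⟩
    rw [le_antisymm h3 h2]; exact not_split_self g S v
  · exact Finset.mem_filter.1 h1

theorem blockStart_le_of (hu : u ∈ x) (huv : u ≤ v)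
    (h : ∀ w ∈ x, u ≤ w → w ≤ v → ¬ Split g S w v) : blockStart g S x v ≤ u := by
  classical
  exact Finset.min'_le _ _ (Finset.mem_insert_of_mem (Finset.mem_filter.2 ⟨hu, huv, h⟩))

theorem blockStart_eq_of_mem (hg : Function.Injective g) (hS : ∀ d ∈ x, d ∉ S) (hu : u ∈ x)
    (hv : v ∈ x) (h1 : blockStart g S x v ≤ u) (h2 : u ≤ v) :
    blockStart g S x u = blockStart g S x v := by
  obtain ⟨a1, a2, a3⟩ := blockStart_spec (g := g) (S := S) hv
  obtain ⟨b1, b2, b3⟩ := blockStart_spec (g := g) (S := S) hu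
  refine le_antisymm (blockStart_le_of a1 h1 fun w hw c1 c2 => ?_)
    (blockStart_le_of b1 (b2.trans h2) fun w hw c1 c2 => ?_)
  · exact not_split_trans hg (hS v hv) (a3 w hw c1 (c2.trans h2)) fun h => a3 u hu h1 h2 h.symm
  · rcases le_total w u with h | h
    · exact not_split_trans hg (hS u hu) (b3 w hw c1 h) (a3 u hu h1 h2)
    · exact a3 w hw (h1.trans h) c2

theorem blockStart_idem (hg : Function.Injective g) (hS : ∀ d ∈ x, d ∉ S) (hv : v ∈ x) :
    blockStart g S x (blockStart g S x v) = blockStart g S x v :=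
  blockStart_eq_of_mem hg hS (blockStart_spec hv).1 hv le_rfl (blockStart_spec hv).2.1

theorem blockStart_mono (hg : Function.Injective g) (hS : ∀ d ∈ x, d ∉ S) (hu : u ∈ x)
    (hv : v ∈ x) (h : u ≤ v) : blockStart g S x u ≤ blockStart g S x v := by
  rcases le_or_gt (blockStart g S x v) u with h1 | h1
  · exact (blockStart_eq_of_mem hg hS hu hv h1 h).le
  · exact (blockStart_spec hu).2.1.trans h1.le

theorem lt_iff_blockStart_lt (hg : Function.Injective g) (hS : ∀ d ∈ x, d ∉ S) (hu : u ∈ x)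
    (hv : v ∈ x) (h : blockStart g S x u ≠ blockStart g S x v) :
    u < v ↔ blockStart g S x u < blockStart g S x v := by
  constructor
  · exact fun h1 => lt_of_le_of_ne (blockStart_mono hg hS hu hv h1.le) h
  · intro h1
    by_contra h2
    exact absurd (blockStart_mono hg hS hv hu (not_lt.1 h2)) (not_le.2 h1)

theorem not_split_of_blockStart_eq (hu : u ∈ x) (hv : v ∈ x)
    (h : blockStart g S x u = blockStart g S x v) : ¬ Split g S u v := by
  rcases le_total u v with h1 | h1
  · exact (blockStart_spec hv).2.2 u hu (h ▸ (blockStart_spec hu).2.1) h1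
  · exact fun h2 => (blockStart_spec hu).2.2 v hv (h ▸ (blockStart_spec hv).2.1) h1 h2.symm

/-- Maximality of the block of `v`: without such a `w` it would reach back to `u`. -/
theorem exists_split_of_blockStart_ne (hg : Function.Injective g) (hS : ∀ d ∈ x, d ∉ S)
    (hu : u ∈ x) (hv : v ∈ x) (huv : u < v) (h : blockStart g S x u ≠ blockStart g S x v) :
    ∃ w ∈ x, u ≤ w ∧ w < blockStart g S x v ∧ Split g S w v := by
  have h1 : u < blockStart g S x v := by
    by_contra h1
    exact h (blockStart_eq_of_mem hg hS hu hv (not_lt.1 h1) huv.le)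
  by_contra! h2
  refine absurd (blockStart_le_of hu huv.le fun w hw c1 c2 => ?_) (not_le.2 h1)
  rcases lt_or_ge w (blockStart g S x v) with h3 | h3
  · exact h2 w hw c1 h3
  · exact (blockStart_spec hv).2.2 w hw h3 c2

end Splitting

/-- A set `G` of points of a permutation without `k`-almost mixed minor, together with a point `a`
on its left and a point `b` on its right, both of extreme value. -/
structure Frame {n : ℕ} (k r : ℕ) (g : Fin n → ℕ) (G : Finset (Fin n)) (a b : Fin n) : Prop where
  two_le : 2 ≤ k
  inj : Function.Injective g
  free : ¬ HasMonoMinor k g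
  hyp : ∀ m : ℕ, almostMixedFreePerms (k - 1) m ⊆ separablePerms m ^ r
  a_lt : ∀ v ∈ G, a < v
  lt_b : ∀ v ∈ G, v < b
  a_ext : (∀ v ∈ G, g a < g v) ∨ (∀ v ∈ G, g v < g a)
  b_ext : (∀ v ∈ G, g b < g v) ∨ (∀ v ∈ G, g v < g b)

/-- The set `x` is an interval of `G`. -/
def IntervalIn {n : ℕ} (G x : Finset (Fin n)) : Prop :=
  x ⊆ G ∧ ∀ u ∈ x, ∀ w ∈ x, ∀ v ∈ G, u ≤ v → v ≤ w → v ∈ x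

/-! ### Colouring the blocks, ordering their first points, gluing block orders -/

namespace Frame

variable {n k r l : ℕ} {g : Fin n → ℕ} {G : Finset (Fin n)} {a b : Fin n}

/-- The blocks of `x` can be coloured with `k` colours such that blocks of the same colour have
disjoint ranges of values. -/
theorem exists_block_coloring (F : Frame k r g G a b) {x S : Finset (Fin n)} (hxG : x ⊆ G)
    (hS : ∀ d ∈ x, d ∉ S) : ∃ c : Fin n → ℕ, (∀ v ∈ x, c v < k) ∧
      (∀ u ∈ x, ∀ v ∈ x, blockStart g S x u = blockStart g S x v → c u = c v) ∧
      ∀ u ∈ x, ∀ v ∈ x, blockStart g S x u ≠ blockStart g S x v → c u = c v →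
        (g u < g v ↔ g (blockStart g S x u) < g (blockStart g S x v)) := by
  set β := blockStart g S x with hβ
  have hβx : ∀ v ∈ x, β v ∈ x := fun v hv => (blockStart_spec hv).1
  have hββ : ∀ v ∈ x, β (β v) = β v := fun v hv => blockStart_idem F.inj hS hv
  have hex : ∀ e, ∃ lo hi, e ∈ x.image β → lo ∈ x ∧ hi ∈ x ∧ β lo = e ∧ β hi = e ∧
      ∀ v ∈ x, β v = e → g lo ≤ g v ∧ g v ≤ g hi := by
    intro e
    by_cases he : e ∈ x.image β
    · obtain ⟨v, hv, rfl⟩ := Finset.mem_image.1 he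
      have hne : (x.filter (β · = β v)).Nonempty := ⟨v, by simp [hv]⟩
      obtain ⟨lo, hlo, hlo'⟩ := Finset.exists_min_image _ g hne
      obtain ⟨hi, hhi, hhi'⟩ := Finset.exists_max_image _ g hne
      rw [Finset.mem_filter] at hlo hhi
      exact ⟨lo, hi, fun _ => ⟨hlo.1, hhi.1, hlo.2, hhi.2, fun w hw hwe =>
        ⟨hlo' w (Finset.mem_filter.2 ⟨hw, hwe⟩), hhi' w (Finset.mem_filter.2 ⟨hw, hwe⟩)⟩⟩⟩
    · exact ⟨e, e, fun h => absurd h he⟩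
  choose lo hi hlohi using hex
  have himg : ∀ e ∈ x.image β, e ∈ x ∧ β e = e := by
    intro e he
    obtain ⟨v, hv, rfl⟩ := Finset.mem_image.1 he
    exact ⟨hβx v hv, hββ v hv⟩
  have hin : ∀ e ∈ x.image β, ∀ w ∈ x, β w = e →
      e ≤ w ∧ ∀ e' ∈ x.image β, e < e' → w < e' := by
    rintro e he w hw rfl
    refine ⟨(blockStart_spec hw).2.1, fun e' he' hlt => ?_⟩
    by_contra h
    have := blockStart_mono F.inj hS (himg e' he').1 hw (not_lt.1 h)
    rw [← hβ, (himg e' he').2] at this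
    exact absurd this (not_le.2 hlt)
  -- A clique gives blocks with a common level `p`; what remains is to find a point `u` beyond all
  -- their ranges after each block start.
  have hclique : ∀ T ⊆ x.image β, ∀ p, (∀ i ∈ T, g (lo i) ≤ p ∧ p ≤ g (hi i)) → T.card < k := by
    intro T hT p hp
    by_contra hcard
    obtain ⟨T', hT'T, hT'⟩ := Finset.exists_subset_card_eq (not_lt.1 hcard)
    have hT'I := hT'T.trans hT
    have hu : ∀ e, ∃ u, e ∈ T' → (e ≤ u ∧ ∀ e' ∈ T', e < e' → u < e') ∧
        ((∀ e' ∈ T', g (hi e') < g u) ∨ (∀ e' ∈ T', g u < g (lo e'))) := by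
      intro e
      by_cases he : e ∈ T'
      swap
      · exact ⟨e, fun h => absurd h he⟩
      have heI := himg e (hT'I he)
      rcases (T'.filter (e < ·)).eq_empty_or_nonempty with hemp | hne
      -- No later block bounds the last part, so it may reach as far as `b`.
      · refine ⟨b, fun _ => ⟨⟨(F.lt_b e (hxG heI.1)).le, fun e' he' hlt => ?_⟩, ?_⟩⟩
        · have : e' ∈ T'.filter (e < ·) := Finset.mem_filter.2 ⟨he', hlt⟩
          rw [hemp] at this
          exact absurd this (Finset.notMem_empty _)
        · rcases F.b_ext with h | h
          · exact .inr fun e' he' => h _ (hxG (hlohi e' (hT'I he')).1)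
          · exact .inl fun e' he' => h _ (hxG (hlohi e' (hT'I he')).2.1)
      · obtain ⟨e₁, he₁, hmin⟩ := Finset.exists_min_image _ id hne
        rw [Finset.mem_filter] at he₁
        have he₁I := himg e₁ (hT'I he₁.1)
        obtain ⟨w, hw, h1, h2, d, hd, hs⟩ := exists_split_of_blockStart_ne (g := g) F.inj hS heI.1
          he₁I.1 he₁.2 (by rw [← hβ, heI.2, he₁I.2]; exact he₁.2.ne)
        rw [← hβ, he₁I.2] at h2
        -- The point `d` splits no block and every range contains `p`, so all ranges lie on the side
        -- of `d` where `p` is. So does `e₁`, and `w` on the other side is beyond them all.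
        have side : ∀ t ∈ T', (g (lo t) < g d ∧ g (hi t) < g d ∧ p < g d) ∨
            (g d < g (lo t) ∧ g d < g (hi t) ∧ g d < p) := by
          intro t ht
          obtain ⟨q1, q2, q3, q4, -⟩ := hlohi t (hT'I ht)
          have hns := not_split_of_blockStart_eq (g := g) q1 q2 (q3.trans q4.symm)
          have := lt_iff_of_not_split F.inj hns hd (hS _ q1) (hS _ q2)
          have h3 : g (lo t) ≠ g d := fun e => hS _ q1 (by rwa [F.inj e])
          have h4 : g (hi t) ≠ g d := fun e => hS _ q2 (by rwa [F.inj e])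
          have := hp t (hT'T ht)
          omega
        have hside₁ := side e₁ he₁.1
        have he₁d : g e₁ < g d ↔ p < g d := by
          obtain ⟨q1, q2, q3, q4, -⟩ := hlohi e₁ (hT'I he₁.1)
          have hns := not_split_of_blockStart_eq (g := g) he₁I.1 q1 (he₁I.2.trans q3.symm)
          have := lt_iff_of_not_split F.inj hns hd (hS _ he₁I.1) (hS _ q1)
          omega
        refine ⟨w, fun _ => ⟨⟨h1, fun e' he' hlt => lt_of_lt_of_le h2
          (hmin e' (Finset.mem_filter.2 ⟨he', hlt⟩))⟩, ?_⟩⟩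
        rcases hs with hs | hs
        · refine .inr fun t ht => ?_
          have := side t ht
          omega
        · refine .inl fun t ht => ?_
          have := side t ht
          omega
    choose u hu using hu
    refine F.free (hasMonoMinor_of_common_level (p := p) (lo := lo) (hi := hi) (u := u) F.inj
      (by have := F.two_le; omega) hT' (fun e he => ?_) (fun e he => ?_) (fun e he => (hu e he).1)
      (fun e he => hp e (hT'T he)) (fun e he => (hu e he).2))
    · obtain ⟨q1, q2, q3, q4, -⟩ := hlohi e (hT'I he)
      obtain ⟨h1, h2⟩ := hin e (hT'I he) _ q1 q3
      exact ⟨h1, fun e' he' => h2 e' (hT'I he')⟩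
    · obtain ⟨q1, q2, q3, q4, -⟩ := hlohi e (hT'I he)
      obtain ⟨h1, h2⟩ := hin e (hT'I he) _ q2 q4
      exact ⟨h1, fun e' he' => h2 e' (hT'I he')⟩
  have hle : ∀ e ∈ x.image β, g (lo e) ≤ g (hi e) := by
    intro e he
    obtain ⟨q1, q2, q3, q4, h⟩ := hlohi e he
    exact (h _ q1 q3).2
  obtain ⟨c, hck, hc⟩ := exists_interval_coloring (k := k) (x.image β) (fun e => g (lo e))
    (fun e => g (hi e)) hclique hle
  have him : ∀ v ∈ x, β v ∈ x.image β := fun v hv => Finset.mem_image_of_mem _ hv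
  refine ⟨fun v => c (β v), fun v hv => hck _ (him v hv), fun u _ v _ h => congrArg c h,
    fun u hu v hv huv hcc => ?_⟩
  obtain ⟨-, -, -, -, h1⟩ := hlohi _ (him u hu)
  obtain ⟨-, -, -, -, h2⟩ := hlohi _ (him v hv)
  have := h1 u hu rfl
  have := h1 _ (hβx u hu) (hββ u hu)
  have := h2 v hv rfl
  have := h2 _ (hβx v hv) (hββ v hv)
  rcases hc _ (him u hu) _ (him v hv) huv hcc with h | h
  · omega
  · omega

theorem lexOn_ordEq_of_const {ι : Type*} {X Y : Finset ι} {c f : ι → ℕ} (hXY : X ⊆ Y)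
    (hc : ∀ u ∈ X, ∀ v ∈ X, c u = c v) : OrdEq X f (lexOn Y c f) := by
  intro u hu v hv
  rw [lexOn_lt_iff (hXY hu) (hXY hv)]
  have := hc u hu v hv
  omega

/-- The pattern on the first points of the blocks of `x`. -/
theorem chain_blockStarts (F : Frame k r g G a b) (hkl : k ≤ 2 ^ l) {x : Finset (Fin n)}
    (hx : IntervalIn G x) :
    Chain (x.image (blockStart g (G \ x) x)) (r + 4 * l) (fun i => (i : ℕ)) g := by
  classical
  set D := G \ x with hD
  have hxD : ∀ d ∈ x, d ∉ D := fun d hd h => (Finset.mem_sdiff.1 h).2 hd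
  set L := D.filter (fun d => ∀ v ∈ x, d < v) with hL
  set R := D.filter (fun d => ∀ v ∈ x, v < d) with hR
  have hLD : L ⊆ D := Finset.filter_subset _ _
  have hxL : ∀ d ∈ x, d ∉ L := fun d hd h => hxD d hd (hLD h)
  have hLR : ∀ d ∈ D, x.Nonempty → d ∈ L ∨ d ∈ R := by
    rintro d hd ⟨v, hv⟩
    obtain ⟨hdG, hdx⟩ := Finset.mem_sdiff.1 hd
    have hne : ∀ w ∈ x, w ≠ d := by rintro w hw rfl; exact hdx hw
    rcases lt_or_gt_of_ne (hne v hv) with h | h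
    · refine .inr (Finset.mem_filter.2 ⟨hd, fun w hw => ?_⟩)
      by_contra h'
      exact hdx (hx.2 v hv w hw d hdG h.le (not_lt.1 h'))
    · refine .inl (Finset.mem_filter.2 ⟨hd, fun w hw => ?_⟩)
      by_contra h'
      exact hdx (hx.2 w hw v hv d hdG (not_lt.1 h') h.le)
  obtain ⟨c, hck, hcβ, hc⟩ := F.exists_block_coloring hx.1 hxL
  set α := blockStart g D x with hα
  set β := blockStart g L x with hβ
  set E := x.image α with hE
  have hEx : E ⊆ x := by
    intro e he
    obtain ⟨v, hv, rfl⟩ := Finset.mem_image.1 he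
    exact (blockStart_spec hv).1
  have hαE : ∀ e ∈ E, α e = e := by
    intro e he
    obtain ⟨v, hv, rfl⟩ := Finset.mem_image.1 he
    exact blockStart_idem F.inj hxD hv
  have hβx : ∀ v ∈ x, β v ∈ x := fun v hv => (blockStart_spec hv).1
  have hββ : ∀ v ∈ x, β (β v) = β v := fun v hv => blockStart_idem F.inj hxL hv
  set E₂ := E.image β with hE₂
  have hE₂x : E₂ ⊆ x := by
    intro e he
    obtain ⟨v, hv, rfl⟩ := Finset.mem_image.1 he
    exact hβx v (hEx hv)
  have hβE₂ : ∀ e ∈ E₂, β e = e := by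
    intro e he
    obtain ⟨v, hv, rfl⟩ := Finset.mem_image.1 he
    exact hββ v (hEx hv)
  have hcc : ∀ v ∈ x, c (β v) = c v := fun v hv => hcβ _ (hβx v hv) _ hv (hββ v hv)
  have hvinj : ∀ X : Finset (Fin n), ∀ u ∈ X, ∀ v ∈ X, u ≠ v → (u : ℕ) ≠ v :=
    fun _ u _ v _ h => Fin.val_ne_of_ne h
  have hginj : ∀ X : Finset (Fin n), ∀ u ∈ X, ∀ v ∈ X, u ≠ v → g u ≠ g v :=
    fun _ u _ v _ h => F.inj.ne h
  -- Distinct `L`-blocks are separated by points of `L`, which lie on the left together with `a`.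
  have hleft : Chain E₂ r (lexOn E₂ c fun i => (i : ℕ)) (lexOn E₂ c g) := by
    refine Chain.inflate (β := c) (F := id) (G := id) (Chain.of_injOn (fun _ _ _ _ h => h) r)
      (fun j _ => ?_) (fun u hu v hv huv => ?_) (fun u hu v hv huv => ?_)
    · have hsub : E₂.filter (c · = j) ⊆ E₂ := Finset.filter_subset _ _
      have hconst : ∀ u ∈ E₂.filter (c · = j), ∀ v ∈ E₂.filter (c · = j), c u = c v :=
        fun u hu v hv => (Finset.mem_filter.1 hu).2.trans (Finset.mem_filter.1 hv).2.symm
      refine (chain_of_split (S := L) (a := a) (x := x) F.two_le F.inj F.free F.hyp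
        (hsub.trans hE₂x) (.inl ?_) ?_ ?_).congr (lexOn_ordEq_of_const hsub hconst)
        (lexOn_ordEq_of_const hsub hconst)
      · rintro d (hd | rfl) v hv
        · exact (Finset.mem_filter.1 hd).2 v hv
        · exact F.a_lt v (hx.1 hv)
      · exact F.a_ext.imp (fun h v hv => h v (hx.1 hv)) (fun h v hv => h v (hx.1 hv))
      · intro e he e' he' hlt
        have h1 := hβE₂ e (hsub he)
        have h2 := hβE₂ e' (hsub he')
        obtain ⟨w, hw, h3, h4, h5⟩ := exists_split_of_blockStart_ne (g := g) F.inj hxL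
          (hE₂x (hsub he)) (hE₂x (hsub he')) hlt (by rw [← hβ, h1, h2]; exact hlt.ne)
        rw [← hβ, h2] at h4
        exact ⟨w, hw, e', hE₂x (hsub he'), h3, h4.le, hlt.le, le_rfl, h5⟩
    · rw [lexOn_lt_iff hu hv]; simp [huv]
    · rw [lexOn_lt_iff hu hv]; simp [huv]
  -- Equally coloured `L`-blocks have disjoint ranges, so this is an inflation of `hleft`. Inside an
  -- `L`-block only points of `R` separate, and `b` takes the role of `a`.
  have hmid : Chain E r (lexOn E c fun i => (i : ℕ)) (lexOn E c g) := by
    refine Chain.inflate hleft (fun j _ => ?_) (fun u hu v hv huv => ?_) (fun u hu v hv huv => ?_)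
    · have hsub : E.filter (β · = j) ⊆ E := Finset.filter_subset _ _
      have hβeq : ∀ u ∈ E.filter (β · = j), ∀ v ∈ E.filter (β · = j), β u = β v :=
        fun u hu v hv => (Finset.mem_filter.1 hu).2.trans (Finset.mem_filter.1 hv).2.symm
      have hconst : ∀ u ∈ E.filter (β · = j), ∀ v ∈ E.filter (β · = j), c u = c v :=
        fun u hu v hv => hcβ u (hEx (hsub hu)) v (hEx (hsub hv)) (hβeq u hu v hv)
      refine (chain_of_split (S := R) (a := b) (x := x) F.two_le F.inj F.free F.hyp
        (hsub.trans hEx) (.inr ?_) ?_ ?_).congr (lexOn_ordEq_of_const hsub hconst)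
        (lexOn_ordEq_of_const hsub hconst)
      · rintro d (hd | rfl) v hv
        · exact (Finset.mem_filter.1 hd).2 v hv
        · exact F.lt_b v (hx.1 hv)
      · exact F.b_ext.imp (fun h v hv => h v (hx.1 hv)) (fun h v hv => h v (hx.1 hv))
      · intro e he e' he' hlt
        have hex := hEx (hsub he)
        have hex' := hEx (hsub he')
        have h1 := hαE e (hsub he)
        have h2 := hαE e' (hsub he')
        obtain ⟨w, hw, h3, h4, d, hd, h5⟩ := exists_split_of_blockStart_ne (g := g) F.inj hxD
          hex hex' hlt (by rw [← hα, h1, h2]; exact hlt.ne)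
        rw [← hα, h2] at h4
        refine ⟨w, hw, e', hex', h3, h4.le, hlt.le, le_rfl, d, ?_, h5⟩
        refine (hLR d hd ⟨e, hex⟩).resolve_left fun hdL => ?_
        refine (blockStart_spec (g := g) (S := L) hex').2.2 w hw ?_ h4.le ⟨d, hdL, h5⟩
        rw [← hβ, ← hβeq e he e' he']
        exact (blockStart_spec hex).2.1.trans h3
    · have hux := hEx hu
      have hvx := hEx hv
      rw [lexOn_lt_iff hu hv, lexOn_lt_iff (Finset.mem_image_of_mem _ hu)
        (Finset.mem_image_of_mem _ hv), hcc u hux, hcc v hvx, ← Fin.lt_def, ← Fin.lt_def,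
        lt_iff_blockStart_lt F.inj hxL hux hvx huv]
    · have hux := hEx hu
      have hvx := hEx hv
      rw [lexOn_lt_iff hu hv, lexOn_lt_iff (Finset.mem_image_of_mem _ hu)
        (Finset.mem_image_of_mem _ hv), hcc u hux, hcc v hvx]
      refine or_congr Iff.rfl (and_congr_right fun h => hc u hux v hvx huv h)
  -- Ranges are disjoint only within a colour, so both ends are sorted by colour, at 2l each.
  have h1 := Chain.color_sort (X := E) (f := fun i : Fin n => (i : ℕ)) (c := c) (l := l)
    (fun v hv => (hck v (hEx hv)).trans_le hkl) (hvinj E)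
  have h2 := Chain.color_sort (X := E) (f := g) (c := c) (l := l)
    (fun v hv => (hck v (hEx hv)).trans_le hkl) (hginj E)
  have h3 := (h1.trans hmid).trans h2.symm
  rwa [show 2 * l + r + 2 * l = r + 4 * l by ring] at h3

/-- The choice depends only on the class as a set, so related points get the same representative. -/
theorem exists_representatives {α : Type*} {x : Finset α} (R : α → α → Prop)
    (hrefl : ∀ v ∈ x, R v v) (hsymm : ∀ u ∈ x, ∀ v ∈ x, R u v → R v u)
    (htrans : ∀ u ∈ x, ∀ v ∈ x, ∀ w ∈ x, R u v → R v w → R u w) :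
    ∃ ω : α → α, ∀ v ∈ x, ω v ∈ x ∧ R v (ω v) ∧ ∀ u ∈ x, R u v → ω u = ω v := by
  classical
  refine ⟨fun v => if h : (x.filter (R v)).Nonempty then h.choose else v, fun v hv => ?_⟩
  have hne : (x.filter (R v)).Nonempty := ⟨v, Finset.mem_filter.2 ⟨hv, hrefl v hv⟩⟩
  have hch := Finset.mem_filter.1 hne.choose_spec
  have hω : (if h : (x.filter (R v)).Nonempty then h.choose else v) = hne.choose := dif_pos hne
  refine ⟨by dsimp only; rw [hω]; exact hch.1, by dsimp only; rw [hω]; exact hch.2,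
    fun u hu huv => ?_⟩
  have heq : x.filter (R u) = x.filter (R v) := by
    refine Finset.filter_congr fun w hw => ⟨fun h => ?_, fun h => ?_⟩
    · exact htrans v hv u hu w hw (hsymm u hu v hv huv) h
    · exact htrans u hu v hv w hw huv h
  dsimp only
  rw [hω, dif_pos (by rw [heq]; exact hne)]
  congr 1
  simp only [heq]

/-- The order `h` on `x` is reached from the order of positions in `p` steps, it sorts the classes
of points that are not split by the rest of `G`, and it reaches the order of values within each
class in `q` steps. -/
structure IsSorting (g : Fin n → ℕ) (G x : Finset (Fin n)) (p q : ℕ) (h : Fin n → ℕ) : Prop where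
  chain : Chain x p (fun i => (i : ℕ)) h
  sorted : ∀ u ∈ x, ∀ v ∈ x, Split g (G \ x) u v → g u < g v → h u < h v
  classes : ∀ u ∈ x, ∀ U ⊆ x, (∀ v, v ∈ U ↔ v ∈ x ∧ ¬ Split g (G \ x) u v) → Chain U q h g

/-- The recursive step: `h` orders blocks by the values of their representatives and each block by
its own `η`. Inside an unsplit class, `h` and `g` inflate their restrictions to representatives of
the finer classes. These restrictions agree within each colour, by sortedness of `η` inside a block
and by `hsep` across blocks, so they are 4l apart. -/
theorem IsSorting.of_blocks (hg : Function.Injective g) {x : Finset (Fin n)} (hxG : x ⊆ G) {p : ℕ}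
    {β : Fin n → Fin n} {c : Fin n → ℕ} {η : Fin n → Fin n → ℕ}
    (hβx : ∀ v ∈ x, β v ∈ x) (hββ : ∀ v ∈ x, β (β v) = β v)
    (hmono : ∀ u ∈ x, ∀ v ∈ x, β u ≠ β v → (u < v ↔ β u < β v))
    (hns : ∀ u ∈ x, ∀ v ∈ x, β u = β v → ¬ Split g (G \ x) u v) (hc : ∀ v ∈ x, c v < 2 ^ l)
    (hsep : ∀ u ∈ x, ∀ v ∈ x, β u ≠ β v → c u = c v → (g u < g v ↔ g (β u) < g (β v)))
    (hP : Chain (x.image β) p (fun i => (i : ℕ)) g)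
    (hη : ∀ e ∈ x.image β, IsSorting g G (x.filter (β · = e)) p (4 * l) (η e)) :
    ∃ h, IsSorting g G x p (4 * l) h := by
  classical
  have hxD : ∀ v ∈ x, v ∉ G \ x := fun v hv h => (Finset.mem_sdiff.1 h).2 hv
  have him : ∀ v ∈ x, β v ∈ x.image β := fun v hv => Finset.mem_image_of_mem _ hv
  set Y : Fin n → Finset (Fin n) := fun e => x.filter (β · = e) with hY
  have hYx : ∀ e, Y e ⊆ x := fun e => Finset.filter_subset _ _
  have hmemY : ∀ v ∈ x, v ∈ Y (β v) := fun v hv => Finset.mem_filter.2 ⟨hv, rfl⟩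
  have hmemY' : ∀ e, ∀ v ∈ Y e, β v = e := fun e v hv => (Finset.mem_filter.1 hv).2
  have hDY : ∀ u ∈ x, ∀ v ∈ x, β u ≠ β v → v ∈ G \ Y (β u) := fun u _ v hv huv =>
    Finset.mem_sdiff.2 ⟨hxG hv, fun h => huv (hmemY' _ _ h).symm⟩
  have hYD : ∀ e, ∀ v ∈ x, β v = e → v ∉ G \ Y e := by
    rintro e v hv rfl h
    exact (Finset.mem_sdiff.1 h).2 (hmemY v hv)
  set h := lexOn x (fun v => g (β v)) (fun v => η (β v) v) with hh
  have hne : ∀ u ∈ x, ∀ v ∈ x, β u ≠ β v → (h u < h v ↔ g (β u) < g (β v)) := by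
    intro u hu v hv huv
    have := hg.ne huv
    rw [hh, lexOn_lt_iff hu hv]
    simp [this]
  have heq : ∀ e, OrdEq (Y e) (η e) h := by
    intro e u hu v hv
    have hu' := hmemY' e u hu
    have hv' := hmemY' e v hv
    rw [hh, lexOn_lt_iff (hYx e hu) (hYx e hv)]
    simp [hu', hv']
  have hsortY : ∀ u ∈ x, ∀ v ∈ x, β u = β v → Split g (G \ Y (β u)) u v →
      (h u < h v ↔ g u < g v) := by
    intro u hu v hv huv hs
    have hu' := hmemY u hu
    have hv' : v ∈ Y (β u) := by rw [huv]; exact hmemY v hv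
    have hs1 := (hη _ (him u hu)).sorted u hu' v hv' hs
    have hs2 := (hη _ (him u hu)).sorted v hv' u hu' hs.symm
    have he := heq _ u hu' v hv'
    have he' := heq _ v hv' u hu'
    have hgne : g u ≠ g v := by
      obtain ⟨d, -, hd⟩ := hs
      omega
    constructor
    · intro h1
      by_contra h2
      have := he'.1 (hs2 (by omega))
      omega
    · exact fun h1 => he.1 (hs1 h1)
  refine ⟨h, ?_, fun u hu v hv hs hlt => ?_, fun u₀ hu₀ U hUx hU => ?_⟩
  · refine Chain.inflate hP (fun e he => ?_) (fun u hu v hv huv => hmono u hu v hv huv) hne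
    exact (hη e he).chain.congr (OrdEq.refl _ _) (heq e)
  -- Blocks are unsplit, so a point outside `x` that separates `u` from `v` separates their
  -- representatives in the same direction.
  · have huv : β u ≠ β v := fun e => hns u hu v hv e hs
    rw [hne u hu v hv huv]
    obtain ⟨d, hd, hd'⟩ := hs
    have h1 := lt_iff_of_not_split hg (hns u hu _ (hβx u hu) (hββ u hu).symm) hd (hxD u hu)
      (hxD _ (hβx u hu))
    have h2 := lt_iff_of_not_split hg (hns v hv _ (hβx v hv) (hββ v hv).symm) hd (hxD v hv)
      (hxD _ (hβx v hv))
    omega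
  -- The finer classes are those of the blocks; here the other blocks of `x` also count as splitting
  -- points.
  · obtain ⟨ω, hω⟩ := exists_representatives (x := x)
      (fun u v => β u = β v ∧ ¬ Split g (G \ Y (β u)) u v)
      (fun v _ => ⟨rfl, not_split_self _ _ _⟩)
      (fun u _ v _ h => ⟨h.1.symm, fun h' => h.2 (by rw [h.1]; exact h'.symm)⟩)
      (fun u _ v hv w _ h h' => ⟨h.1.trans h'.1, not_split_trans hg (hYD _ v hv h.1.symm) h.2
        (by rw [h.1]; exact h'.2)⟩)
    have hωx : ∀ v ∈ x, ω v ∈ x := fun v hv => (hω v hv).1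
    have hωβ : ∀ v ∈ x, β (ω v) = β v := fun v hv => (hω v hv).2.1.1.symm
    have hωs : ∀ v ∈ x, ¬ Split g (G \ Y (β v)) v (ω v) := fun v hv => (hω v hv).2.1.2
    have hωne : ∀ u ∈ x, ∀ v ∈ x, β u = β v → ω u ≠ ω v → Split g (G \ Y (β u)) u v := by
      intro u hu v hv huv hne
      by_contra hs
      exact hne ((hω v hv).2.2 u hu ⟨huv, hs⟩)
    have hωω : ∀ v ∈ x, ω (ω v) = ω v := fun v hv =>
      ((hω (ω v) (hωx v hv)).2.2 v hv (hω v hv).2.1).symm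
    have hωU : ∀ v ∈ U, ω v ∈ U := by
      intro v hv
      obtain ⟨hvx, hvs⟩ := (hU v).1 hv
      exact (hU _).2 ⟨hωx v hvx, not_split_trans hg (hxD v hvx) hvs
        (hns v hvx _ (hωx v hvx) (hωβ v hvx).symm)⟩
    have hgω : ∀ u ∈ x, ∀ v ∈ x, ω u ≠ ω v → (g u < g v ↔ g (ω u) < g (ω v)) := by
      intro u hu v hv huv
      by_cases hβ : β u = β v
      · obtain ⟨d, hd, hd'⟩ := hωne u hu v hv hβ huv
        have h1 := lt_iff_of_not_split hg (hωs u hu) hd (hYD _ u hu rfl)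
          (hYD _ _ (hωx u hu) (hωβ u hu))
        have hdv : d ∈ G \ Y (β v) := by rwa [← hβ]
        have h2 := lt_iff_of_not_split hg (hωs v hv) hdv (hYD _ v hv rfl)
          (hYD _ _ (hωx v hv) (hωβ v hv))
        have h3 : g (ω u) ≠ g d := fun e => hYD _ _ (hωx u hu) (hωβ u hu) (by rwa [hg e])
        have h4 : g (ω v) ≠ g d := fun e => hYD _ _ (hωx v hv) (hωβ v hv) (by rwa [hg e])
        omega
      -- Across blocks, `v` lies outside the block of `u` and cannot separate `u` from `ω u`;
      -- likewise `ω u` cannot separate `v` from `ω v`.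
      · rw [lt_iff_of_not_split hg (hωs u hu) (hDY u hu v hv hβ) (hYD _ u hu rfl)
          (hYD _ _ (hωx u hu) (hωβ u hu))]
        have h1 := lt_iff_of_not_split hg (hωs v hv)
          (hDY v hv (ω u) (hωx u hu) (by rw [hωβ u hu]; exact fun e => hβ e.symm))
          (hYD _ v hv rfl) (hYD _ _ (hωx v hv) (hωβ v hv))
        have h2 : g (ω u) ≠ g v := fun e => hβ (by rw [← hωβ u hu, hg e])
        have h3 : g (ω u) ≠ g (ω v) := hg.ne huv
        omega
    have hhω : ∀ u ∈ x, ∀ v ∈ x, ω u ≠ ω v → (h u < h v ↔ h (ω u) < h (ω v)) := by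
      intro u hu v hv huv
      by_cases hβ : β u = β v
      · have h1 : β (ω u) = β (ω v) := by rw [hωβ u hu, hωβ v hv, hβ]
        rw [hsortY u hu v hv hβ (hωne u hu v hv hβ huv),
          hsortY _ (hωx u hu) _ (hωx v hv) h1 (hωne _ (hωx u hu) _ (hωx v hv) h1
            (by rw [hωω u hu, hωω v hv]; exact huv)), hgω u hu v hv huv]
      · rw [hne u hu v hv hβ, hne _ (hωx u hu) _ (hωx v hv)
          (by rw [hωβ u hu, hωβ v hv]; exact hβ), hωβ u hu, hωβ v hv]
    refine Chain.inflate (β := ω) (F := h) (G := g) ?_ (fun w hw => ?_)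
      (fun u hu v hv => hhω u (hUx hu) v (hUx hv)) (fun u hu v hv => hgω u (hUx hu) v (hUx hv))
    · have hE : ∀ w ∈ U.image ω, w ∈ x ∧ ω w = w := by
        intro w hw
        obtain ⟨v, hv, rfl⟩ := Finset.mem_image.1 hw
        exact ⟨hωx v (hUx hv), hωω v (hUx hv)⟩
      have hginj : ∀ u ∈ U.image ω, ∀ v ∈ U.image ω, u ≠ v → g u ≠ g v :=
        fun u _ v _ huv => hg.ne huv
      have key : ∀ u ∈ U.image ω, ∀ v ∈ U.image ω, u ≠ v → c u = c v → (h u < h v ↔ g u < g v) := by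
        intro u hu v hv huv hcc
        obtain ⟨hux, hωu⟩ := hE u hu
        obtain ⟨hvx, hωv⟩ := hE v hv
        by_cases hβ : β u = β v
        · exact hsortY u hux v hvx hβ (hωne u hux v hvx hβ (by rwa [hωu, hωv]))
        · rw [hne u hux v hvx hβ, hsep u hux v hvx hβ hcc]
      have hhinj : ∀ u ∈ U.image ω, ∀ v ∈ U.image ω, u ≠ v → h u ≠ h v := by
        intro u hu v hv huv
        obtain ⟨hux, hωu⟩ := hE u hu
        obtain ⟨hvx, hωv⟩ := hE v hv
        by_cases hβ : β u = β v
        · have hs := hωne u hux v hvx hβ (by rwa [hωu, hωv])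
          have h1 := hsortY u hux v hvx hβ hs
          have h2 := hsortY v hvx u hux hβ.symm (by rw [← hβ]; exact hs.symm)
          have := hginj u hu v hv huv
          omega
        · have h1 := hne u hux v hvx hβ
          have h2 := hne v hvx u hux (Ne.symm hβ)
          have := hg.ne hβ
          omega
      have h1 := Chain.color_sort (l := l) (c := c) (fun v hv => hc v (hE v hv).1) hhinj
      have h2 := Chain.color_sort (l := l) (c := c) (fun v hv => hc v (hE v hv).1) hginj
      have h3 : OrdEq (U.image ω) (lexOn (U.image ω) c g) (lexOn (U.image ω) c h) := by
        intro u hu v hv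
        rw [lexOn_lt_iff hu hv, lexOn_lt_iff hu hv]
        refine or_congr Iff.rfl (and_congr_right fun hcc => ?_)
        by_cases huv : u = v
        · subst huv; simp
        · exact (key u hu v hv huv hcc).symm
      have h4 := h1.trans (h2.symm.congr h3 (OrdEq.refl _ _))
      rwa [show 2 * l + 2 * l = 4 * l by ring] at h4
    · obtain ⟨v, hv, rfl⟩ := Finset.mem_image.1 hw
      have hvx := hUx hv
      have hsub : U.filter (ω · = ω v) ⊆ Y (β v) := by
        intro w hw
        obtain ⟨hwU, hwω⟩ := Finset.mem_filter.1 hw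
        refine Finset.mem_filter.2 ⟨hUx hwU, ?_⟩
        rw [← hωβ w (hUx hwU), hwω, hωβ v hvx]
      -- A fibre of `ω` in `U` is a full class of its block, because the block is not split by `G \
      -- x` and thus lies within `U` once it meets it.
      refine ((hη _ (him v hvx)).classes v (hmemY v hvx) _ hsub fun w => ?_).congr
        ((heq _).subset hsub) (OrdEq.refl _ _)
      constructor
      · intro hw
        obtain ⟨hwU, hwω⟩ := Finset.mem_filter.1 hw
        refine ⟨hsub hw, fun hs => ?_⟩
        have hwx := hUx hwU
        have hwβ := hmemY' _ _ (hsub hw)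
        refine not_split_trans (v := ω v) hg (hYD _ _ (hωx v hvx) (hωβ v hvx)) (hωs v hvx) ?_ hs
        rw [← hwω, ← hwβ]
        exact fun h => hωs w hwx h.symm
      · rintro ⟨hwY, hws⟩
        have hwx := hYx _ hwY
        have hwβ := hmemY' _ _ hwY
        refine Finset.mem_filter.2 ⟨(hU w).2 ⟨hwx, ?_⟩, ?_⟩
        · exact not_split_trans hg (hxD v hvx) ((hU v).1 hv).2 (hns v hvx w hwx hwβ.symm)
        · exact ((hω w hwx).2.2 v hvx ⟨hwβ.symm, hws⟩).symm

end Frame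

/-! ### The recursion on intervals and the final count -/

namespace Frame

variable {n k r l : ℕ} {g : Fin n → ℕ} {G : Finset (Fin n)} {a b : Fin n}

theorem IsSorting.of_card_le_one {x : Finset (Fin n)} (hx : x.card ≤ 1) (p q : ℕ) :
    IsSorting g G x p q (fun i => (i : ℕ)) := by
  refine ⟨Chain.of_card_le_one hx _ _ _, fun u hu v hv _ h => ?_, fun u _ U hU _ =>
    Chain.of_card_le_one ((Finset.card_le_card hU).trans hx) _ _ _⟩
  rw [Finset.card_le_one.1 hx u hu v hv] at h
  exact absurd h (lt_irrefl _)

/-- Induction on size, so all blocks must be smaller than `x`. This holds for the maximal blocks if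
`x` is split; otherwise the first point is cut off from the rest. -/
theorem exists_isSorting (F : Frame k r g G a b) (hkl : k ≤ 2 ^ l) (N : ℕ) :
    ∀ x : Finset (Fin n), IntervalIn G x → x.card ≤ N →
      ∃ h, IsSorting g G x (r + 4 * l) (4 * l) h := by
  have hl : 1 ≤ l := by
    have := F.two_le
    rcases Nat.eq_zero_or_pos l with rfl | h
    · rw [pow_zero] at hkl; omega
    · exact h
  induction N with
  | zero => exact fun x _ hx => ⟨_, IsSorting.of_card_le_one (by omega) _ _⟩
  | succ N ih =>
    intro x hx hcard
    by_cases hx1 : x.card ≤ 1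
    · exact ⟨_, IsSorting.of_card_le_one hx1 _ _⟩
    have hxD : ∀ d ∈ x, d ∉ G \ x := fun d hd h => (Finset.mem_sdiff.1 h).2 hd
    have hblocks : ∀ β : Fin n → Fin n, (∀ e, ∃ v ∈ x, β v ≠ e) →
        (∀ u ∈ x, ∀ w ∈ x, β u = β w → ∀ v ∈ x, u ≤ v → v ≤ w → β v = β w) →
        ∃ η : Fin n → Fin n → ℕ, ∀ e ∈ x.image β,
          IsSorting g G (x.filter (β · = e)) (r + 4 * l) (4 * l) (η e) := by
      intro β h1 h2
      have : ∀ e, ∃ h, IsSorting g G (x.filter (β · = e)) (r + 4 * l) (4 * l) h := by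
        intro e
        refine ih _ ⟨(Finset.filter_subset _ _).trans hx.1, fun u hu w hw v hv huv hvw => ?_⟩ ?_
        · obtain ⟨hux, rfl⟩ := Finset.mem_filter.1 hu
          obtain ⟨hwx, hwe⟩ := Finset.mem_filter.1 hw
          have hvx := hx.2 u hux w hwx v hv huv hvw
          exact Finset.mem_filter.2 ⟨hvx, (h2 u hux w hwx hwe.symm v hvx huv hvw).trans hwe⟩
        · obtain ⟨v, hv, hve⟩ := h1 e
          have : (x.filter (β · = e)).card < x.card := Finset.card_lt_card
            ((Finset.filter_ssubset).2 ⟨v, hv, hve⟩)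
          omega
      choose η hη using this
      exact ⟨η, fun e _ => hη e⟩
    by_cases hsplit : ∃ u ∈ x, ∃ v ∈ x, Split g (G \ x) u v
    · obtain ⟨u₀, hu₀, v₀, hv₀, hs₀⟩ := hsplit
      obtain ⟨c, hck, -, hc⟩ := F.exists_block_coloring hx.1 hxD
      have hne : ∀ e, ∃ v ∈ x, blockStart g (G \ x) x v ≠ e := by
        intro e
        by_contra! h
        exact not_split_of_blockStart_eq hu₀ hv₀ ((h u₀ hu₀).trans (h v₀ hv₀).symm) hs₀
      obtain ⟨η, hη⟩ := hblocks (blockStart g (G \ x) x) hne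
        (fun u hu w hw huw v hv huv hvw => le_antisymm (blockStart_mono F.inj hxD hv hw hvw)
          (huw ▸ blockStart_mono F.inj hxD hu hv huv))
      exact IsSorting.of_blocks F.inj hx.1 (fun v hv => (blockStart_spec hv).1)
        (fun v hv => blockStart_idem F.inj hxD hv)
        (fun u hu v hv => lt_iff_blockStart_lt F.inj hxD hu hv)
        (fun u hu v hv => not_split_of_blockStart_eq hu hv)
        (fun v hv => (hck v hv).trans_le hkl) hc (F.chain_blockStarts hkl hx) hη
    · have hns : ∀ u ∈ x, ∀ v ∈ x, ¬ Split g (G \ x) u v :=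
        fun u hu v hv h => hsplit ⟨u, hu, v, hv, h⟩
      obtain ⟨f₀, hf₀, hmin⟩ := Finset.exists_min_image x id
        (Finset.card_pos.1 (by omega))
      obtain ⟨f₁, hf₁, hf⟩ := Finset.exists_mem_ne (by omega : 1 < x.card) f₀
      set β : Fin n → Fin n := fun v => if v = f₀ then f₀ else f₁ with hβ
      have hβ0 : ∀ v, v = f₀ → β v = f₀ := fun v h => if_pos h
      have hβ1 : ∀ v, v ≠ f₀ → β v = f₁ := fun v h => if_neg h
      have hβiff : ∀ u v, β u ≠ β v → (u = f₀ ∧ v ≠ f₀) ∨ (u ≠ f₀ ∧ v = f₀) := by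
        intro u v h
        by_cases hu : u = f₀ <;> by_cases hv : v = f₀
        · exact absurd ((hβ0 u hu).trans (hβ0 v hv).symm) h
        · exact .inl ⟨hu, hv⟩
        · exact .inr ⟨hu, hv⟩
        · exact absurd ((hβ1 u hu).trans (hβ1 v hv).symm) h
      have hlt : ∀ v ∈ x, v ≠ f₀ → f₀ < v := fun v hv h => lt_of_le_of_ne (hmin v hv) h.symm
      have hother : ∀ e, ∃ v ∈ x, β v ≠ e := by
        intro e
        by_cases h : e = f₀
        · exact ⟨f₁, hf₁, by rw [hβ1 f₁ hf, h]; exact hf⟩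
        · exact ⟨f₀, hf₀, by rw [hβ0 f₀ rfl]; exact Ne.symm h⟩
      have hconv : ∀ u ∈ x, ∀ w ∈ x, β u = β w → ∀ v ∈ x, u ≤ v → v ≤ w → β v = β w := by
        intro u hu w hw huw v hv huv hvw
        by_contra hne
        rcases hβiff v w hne with ⟨h1, h2⟩ | ⟨h1, h2⟩
        · have h3 : u = f₀ := le_antisymm (h1 ▸ huv) (hmin u hu)
          rw [hβ0 u h3, hβ1 w h2] at huw
          exact hf huw.symm
        · exact absurd (hlt v hv h1) (not_lt.2 (h2 ▸ hvw))
      obtain ⟨η, hη⟩ := hblocks β hother hconv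
      -- The two blocks get different colours, which makes the separation condition vacuous; `1 ≤ l`
      -- provides two colours.
      refine IsSorting.of_blocks (c := fun v => if v = f₀ then 0 else 1) (β := β) F.inj hx.1
        (fun v hv => ?_) (fun v hv => ?_) (fun u hu v hv huv => ?_)
        (fun u hu v hv _ => hns u hu v hv) (fun v hv => ?_) (fun u hu v hv huv hcc => ?_) ?_ hη
      · by_cases h : v = f₀
        · rw [hβ0 v h]; exact hf₀
        · rw [hβ1 v h]; exact hf₁
      · by_cases h : v = f₀
        · rw [hβ0 v h, hβ0 f₀ rfl]
        · rw [hβ1 v h, hβ1 f₁ hf]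
      · rcases hβiff u v huv with ⟨h1, h2⟩ | ⟨h1, h2⟩
        · rw [hβ0 u h1, hβ1 v h2, h1]
          exact iff_of_true (hlt v hv h2) (hlt f₁ hf₁ hf)
        · rw [hβ1 u h1, hβ0 v h2, h2]
          exact iff_of_false (hlt u hu h1).not_gt (hlt f₁ hf₁ hf).not_gt
      · have : 2 ^ 1 ≤ 2 ^ l := Nat.pow_le_pow_right two_pos hl
        split_ifs <;> omega
      · rcases hβiff u v huv with ⟨h1, h2⟩ | ⟨h1, h2⟩ <;> simp [h1, h2] at hcc
      · have himg : ∀ e ∈ x.image β, e = f₀ ∨ e = f₁ := by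
          intro e he
          obtain ⟨v, hv, rfl⟩ := Finset.mem_image.1 he
          by_cases h : v = f₀
          · exact .inl (hβ0 v h)
          · exact .inr (hβ1 v h)
        have hf01 : (f₀ : ℕ) < f₁ := hlt f₁ hf₁ hf
        have hg01 : g f₀ ≠ g f₁ := F.inj.ne hf.symm
        refine (Chain.single (SepOn.of_extreme (fun u _ v _ h => Fin.val_ne_of_ne h)
          fun m hm => ?_)).mono (by omega) (fun u _ v _ h => F.inj.ne h)
        rcases lt_or_gt_of_ne hg01 with h | h
        · refine .inl fun e he hem => ?_
          rcases himg m hm with rfl | rfl <;> rcases himg e he with rfl | rfl <;> omega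
        · refine .inr fun e he hem => ?_
          rcases himg m hm with rfl | rfl <;> rcases himg e he with rfl | rfl <;> omega

/-- No point of `G` lies outside `G`, so all of `G` is one class: r + 4l steps to `h` and 4l from
`h` to `g`. -/
theorem chain (F : Frame k r g G a b) (hkl : k ≤ 2 ^ l) :
    Chain G (r + 8 * l) (fun i => (i : ℕ)) g := by
  rcases G.eq_empty_or_nonempty with rfl | ⟨u, hu⟩
  · exact Chain.of_card_le_one (by simp) _ _ _
  obtain ⟨h, hh⟩ := F.exists_isSorting hkl G.card G
    ⟨Finset.Subset.refl G, fun _ _ _ _ _ hv _ _ => hv⟩ le_rfl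
  have h1 := hh.classes u hu G (Finset.Subset.refl G) fun v => by
    simp only [sdiff_self, iff_self_and]
    rintro - ⟨d, hd, -⟩
    simp at hd
  have := hh.chain.trans h1
  rwa [show r + 4 * l + 4 * l = r + 8 * l by ring] at this

end Frame

/-- A permutation without `k`-almost mixed minor is a product of `r + 8 l + 6` separable ones if
`k ≤ 2 ^ l`. -/
theorem mem_pow_of_mem_almostMixedFreePerms {k r l n : ℕ} (hk : 2 ≤ k) (hkl : k ≤ 2 ^ l)
    (hyp : ∀ m : ℕ, almostMixedFreePerms (k - 1) m ⊆ separablePerms m ^ r)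
    {σ : Equiv.Perm (Fin n)} (hσ : σ ∈ almostMixedFreePerms k n) {s : ℕ}
    (hs : r + 8 * l + 6 ≤ s) : σ ∈ separablePerms n ^ s := by
  classical
  set g : Fin n → ℕ := fun i => (σ i : ℕ) with hgdef
  have hg : Function.Injective g := Fin.val_injective.comp σ.injective
  have hginj : ∀ X : Finset (Fin n), ∀ u ∈ X, ∀ v ∈ X, u ≠ v → g u ≠ g v :=
    fun _ u _ v _ h => hg.ne h
  suffices h : Chain Finset.univ s (fun i => ((1 : Equiv.Perm (Fin n)) i : ℕ)) g by
    simpa using Chain.mem_pow (q := σ) h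
  rcases Nat.eq_zero_or_pos n with rfl | hn
  · exact Chain.of_card_le_one (by simp) _ _ _
  set a : Fin n := ⟨0, hn⟩ with ha
  set b : Fin n := ⟨n - 1, by omega⟩ with hb
  -- Monotone in the value, at most 4, with `a` and `b` alone in their classes. Three bits suffice,
  -- which costs 6 steps, and `a`, `b` are extreme for every other class.
  set q : Fin n → ℕ := fun v => (if g a < g v then 1 else 0) + (if g a ≤ g v then 1 else 0) +
    (if g b < g v then 1 else 0) + (if g b ≤ g v then 1 else 0) with hq
  have hqg : ∀ u v, g u < g v → q u ≤ q v := by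
    intro u v h
    simp only [hq]
    split_ifs <;> omega
  have hqa : ∀ v, q v = q a → v = a := by
    intro v hv
    by_contra hne
    have := hg.ne hne
    simp only [hq] at hv
    split_ifs at hv <;> omega
  have hqb : ∀ v, q v = q b → v = b := by
    intro v hv
    by_contra hne
    have := hg.ne hne
    simp only [hq] at hv
    split_ifs at hv <;> omega
  have hq5 : ∀ v, q v < 2 ^ 3 := by
    intro v
    simp only [hq]
    split_ifs <;> omega
  have h1 := Chain.color_sort (X := Finset.univ) (f := fun i : Fin n => (i : ℕ)) (c := q) (l := 3)
    (fun v _ => hq5 v) (fun u _ v _ h => Fin.val_ne_of_ne h)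
  have h2 : Chain Finset.univ (r + 8 * l) (lexOn Finset.univ q fun i : Fin n => (i : ℕ)) g := by
    refine Chain.inflate (β := q) (F := id) (G := id) (Chain.of_injOn (fun _ _ _ _ h => h) _)
      (fun t _ => ?_) (fun u hu v hv huv => ?_) (fun u hu v hv huv => ?_)
    · set G : Finset (Fin n) := Finset.univ.filter (q · = t) with hG
      have hmem : ∀ v ∈ G, q v = t := fun v hv => (Finset.mem_filter.1 hv).2
      refine Chain.congr ?_ (Frame.lexOn_ordEq_of_const (Finset.subset_univ _)
        fun u hu v hv => (hmem u hu).trans (hmem v hv).symm) (OrdEq.refl _ _)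
      by_cases hat : q a = t
      · refine Chain.of_card_le_one (Finset.card_le_one.2 fun u hu v hv => ?_) _ _ _
        rw [hqa u ((hmem u hu).trans hat.symm), hqa v ((hmem v hv).trans hat.symm)]
      by_cases hbt : q b = t
      · refine Chain.of_card_le_one (Finset.card_le_one.2 fun u hu v hv => ?_) _ _ _
        rw [hqb u ((hmem u hu).trans hbt.symm), hqb v ((hmem v hv).trans hbt.symm)]
      have hext : ∀ z, q z ≠ t → (∀ v ∈ G, g z < g v) ∨ (∀ v ∈ G, g v < g z) := by
        intro z hz
        by_cases h : ∃ u ∈ G, g z < g u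
        · obtain ⟨u, hu, hzu⟩ := h
          refine .inl fun v hv => ?_
          by_contra hvz
          have h3 := hmem u hu
          have h4 := hmem v hv
          have h5 : g v ≠ g z := hg.ne (by rintro rfl; exact hz h4)
          have := hqg z u hzu
          have := hqg v z (by omega)
          omega
        · refine .inr fun v hv => ?_
          have h5 : g v ≠ g z := hg.ne (by rintro rfl; exact hz (hmem v hv))
          by_contra h6
          exact h ⟨v, hv, by omega⟩
      have F : Frame k r g G a b :=
        { two_le := hk
          inj := hg
          free := fun h => hσ (h.hasAlmostMixedMinor hk)
          hyp := hyp
          a_lt := fun v hv => lt_of_le_of_ne (Fin.le_def.2 (Nat.zero_le _))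
            (by rintro rfl; exact hat (hmem _ hv))
          lt_b := fun v hv => lt_of_le_of_ne (Fin.le_def.2 (by simp only [hb]; omega))
            (by rintro rfl; exact hbt (hmem _ hv))
          a_ext := hext a hat
          b_ext := hext b hbt }
      exact F.chain hkl
    · rw [lexOn_lt_iff hu hv]; simp [huv]
    · have := hqg u v
      have := hqg v u
      have : g u ≠ g v := hg.ne (by rintro rfl; exact huv rfl)
      simp only [id]
      omega
  exact (h1.trans h2).mono (by omega) (hginj _)

end SepPerm

theorem mainTheorem2 (k r : ℕ) (hk : 1 ≤ k)
    (h : ∀ n : ℕ, SepPerm.almostMixedFreePerms (k - 1) n ⊆ SepPerm.separablePerms n ^ r) :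
    ∀ n : ℕ, SepPerm.almostMixedFreePerms k n ⊆
      SepPerm.separablePerms n ^ (3 * r + 12 * ⌈Real.logb 2 (k : ℝ)⌉₊ + 28) := by
  intro n σ hσ
  rcases Nat.lt_or_ge k 2 with hk2 | hk2
  · obtain rfl : k = 1 := by omega
    rcases Nat.eq_zero_or_pos n with rfl | hn
    · have h1 : SepPerm.Chain Finset.univ (3 * r + 12 * ⌈Real.logb 2 ((1 : ℕ) : ℝ)⌉₊ + 28)
          (fun i => ((1 : Equiv.Perm (Fin 0)) i : ℕ)) (fun i => (σ i : ℕ)) :=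
        SepPerm.Chain.of_card_le_one (by simp) _ _ _
      simpa using SepPerm.Chain.mem_pow (q := σ) h1
    · let P : SepPerm.IntervalPartition (Fin n) 1 :=
        { part := fun _ => Set.univ
          nonempty := fun _ => ⟨⟨0, hn⟩, trivial⟩
          cover := fun _ => ⟨0, trivial⟩
          ordConnected := fun _ => Set.ordConnected_univ
          lt_of_lt := fun i j hij => absurd (Subsingleton.elim i j) hij.ne }
      exact absurd ⟨P, P, fun i j hij => absurd (Subsingleton.elim i j) hij⟩ hσ
  · have hclog : ⌈Real.logb 2 (k : ℝ)⌉₊ = Nat.clog 2 k := by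
      exact_mod_cast Real.natCeil_logb_natCast 2 k
    rw [hclog]
    exact SepPerm.mem_pow_of_mem_almostMixedFreePerms hk2 (Nat.le_pow_clog one_lt_two k) h hσ
      (by omega)
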